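/- Let $d\ge 3$, let $\gamma(t)=(t,t^2,\dots,t^{d-1})$, and for nonnegative $f$ on $\mathbb{R}^d=\mathbb{R}\times\mathbb{R}^{d-1}$ put $$Xf(t,y)=\int_{\mathbb{R}} f(s,y+s\gamma(t))\,ds,\qquad (t,y)\in\mathbb{R}\times\mathbb{R}^{d-1}.$$ For $\theta\in(0,1)$ define $p_\theta,q_\theta,r_\theta$ by $$\Big(\frac1{p_\theta},\frac1{q_\theta},\frac1{r_\theta}\Big)=\Big(1-\theta+\frac{\theta d}{d+2},\ \frac{\theta d}{d+2},\ 1-\theta+\frac{\theta(d^2-d-2)}{d^2+d-2}\Big),$$ let $q_\theta',r_\theta'$ be the dual exponents, and write $\|g\|_{L^q_tL^r_y}=\big(\int_{\mathbb{R}}(\int_{\mathbb{R}^{d-1}} g(t,y)^r\,dy)^{q/r}\,dt\big)^{1/q}$ for nonnegative $g$. For all constants $a,b,m,M>0$ there exist constants $c,C,k>0$, depending only on $d,\theta,a,b,m,M$, such that the following holds. Let $\epsilon>0$, let $E_1,E_2,F\subset\mathbb{R}^d$ be Lebesgue measurable sets of positive finite measure, and suppose that for some $A>0$ and $T\subset\mathbb{R}$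 $$m\,A\,\chi_T(t)\ \le\ \|\chi_F(t,\cdot)\|_{L_y^{r_\theta'}}^{r_\theta'}\ \le\ M\,A\,\chi_T(t)\qquad\text{for almost every } t\in\mathbb{R}.$$ Let $\tilde F\subset F$ be measurable with $|\tilde F|\ge a\,\epsilon^{b}|F|$, and suppose that for $i=1,2$ $$X\chi_{E_i}\ \ge\ \epsilon\,|E_i|^{1/p_\theta}\,\|\chi_F\|_{L_t^{q_\theta'}L_y^{r_\theta'}}\,|F|^{-1}\qquad\text{almost everywhere on }\tilde F.$$ Then $$c\,\epsilon^{k}|E_1|\ \le\ |E_2|\ \le\ C\,\epsilon^{-k}|E_1|.$$ -/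

import Mathlib

open MeasureTheory
open scoped ENNReal

noncomputable section

namespace RestrictedXray

/-- `ℝ^d` split as `ℝ × ℝ^{d-1}`, with its product (that is, `d`-dimensional Lebesgue) measure.
Points are written `(s, x)` on the side of functions and `(t, y)` on the side of lines. -/
abbrev Space (d : ℕ) : Type := ℝ × (Fin (d - 1) → ℝ)

/-- The moment curve `γ(t) = (t, t^2, ..., t^{d-1})` in `ℝ^{d-1}`. -/
def momentCurve (d : ℕ) (t : ℝ) : Fin (d - 1) → ℝ := fun i => t ^ ((i : ℕ) + 1)

/-- The restricted X-ray transform `X f (t, y) = ∫ f (s, y + s γ(t)) ds` of a nonnegative `f`. -/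
def xray (d : ℕ) (f : Space d → ℝ≥0∞) (z : Space d) : ℝ≥0∞ :=
  ∫⁻ s : ℝ, f (s, z.2 + s • momentCurve d z.1)

/-- The characteristic function of a set, with values in `[0, ∞]`. -/
def chi {d : ℕ} (E : Set (Space d)) : Space d → ℝ≥0∞ := E.indicator (fun _ => 1)

/-- The norm in `y` at fixed `t`: `‖g(t, ·)‖_{L_y^r}`. -/
def fibreNorm {d : ℕ} (r : ℝ) (g : Space d → ℝ≥0∞) (t : ℝ) : ℝ≥0∞ :=
  eLpNorm (fun y : Fin (d - 1) → ℝ => g (t, y)) (ENNReal.ofReal r) volume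

/-- The mixed norm `‖g‖_{L_t^q L_y^r}`. -/
def mixedNorm {d : ℕ} (q r : ℝ) (g : Space d → ℝ≥0∞) : ℝ≥0∞ :=
  eLpNorm (fibreNorm r g) (ENNReal.ofReal q) volume

/-- `p_θ`, where `1 / p_θ = 1 - θ + θ d / (d + 2)`. -/
def pExp (d : ℕ) (θ : ℝ) : ℝ := (1 - θ + θ * d / (d + 2))⁻¹

/-- `q_θ`, where `1 / q_θ = θ d / (d + 2)`. -/
def qExp (d : ℕ) (θ : ℝ) : ℝ := (θ * d / (d + 2))⁻¹

/-- `r_θ`, where `1 / r_θ = 1 - θ + θ (d^2 - d - 2) / (d^2 + d - 2)`. -/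
def rExp (d : ℕ) (θ : ℝ) : ℝ :=
  (1 - θ + θ * ((d : ℝ) ^ 2 - d - 2) / ((d : ℝ) ^ 2 + d - 2))⁻¹

/-- The dual exponent `q_θ'`. -/
def qDual (d : ℕ) (θ : ℝ) : ℝ := Real.conjExponent (qExp d θ)

/-- The dual exponent `r_θ'`. -/
def rDual (d : ℕ) (θ : ℝ) : ℝ := Real.conjExponent (rExp d θ)

/-- The natural size `ε |E|^{1/p_θ} ‖χ_F‖_{L_t^{q_θ'} L_y^{r_θ'}} |F|⁻¹` of `X χ_E` on `F`. -/
def threshold (d : ℕ) (θ ε : ℝ) (E F : Set (Space d)) : ℝ≥0∞ :=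
  ENNReal.ofReal ε * volume E ^ (1 / pExp d θ) *
    mixedNorm (qDual d θ) (rDual d θ) (chi F) * (volume F)⁻¹

/-- `‖χ_F(t, ·)‖_{L_y^{r}}^{r} ∼ A χ_T(t)` for almost every `t`, with comparability constants
`m` (lower) and `M` (upper). -/
def FibreComparable {d : ℕ} (m M r A : ℝ) (T : Set ℝ) (F : Set (Space d)) : Prop :=
  ∀ᵐ t : ℝ,
    T.indicator (fun _ => ENNReal.ofReal (m * A)) t ≤ fibreNorm r (chi F) t ^ r ∧
    fibreNorm r (chi F) t ^ r ≤ T.indicator (fun _ => ENNReal.ofReal (M * A)) t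

end RestrictedXray

end

/-! Almost every line of `F'` meets `E` in measure at least `α`, the threshold of the theorem. This
bounds the measure `e` of `E` from below and from above in terms of `F` alone.

From below: count the incidences between the points of `E` and a set `G` of such lines of almost
full measure in `F'`. Each line contributes at least `α` and each point at most the measure `τ` of
the set of directions, so `α |G| ≤ τ e`.

From above: Christ's method of refinements. Discarding poor points and poor lines a bounded number
of times keeps a line `ℓ` from which one can switch lines `d - 1` times in a row, each time choosing
a point among measure `≳ α` and a direction among measure `≳ δ = α |G| / e`, the directions being
`δ`-separated. For fixed directions the last line depends affinely on the switching points, with a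
Vandermonde determinant as Jacobian, and it lies in a fibre of `F` of measure `≲ A`. Integrating
over the directions gives `α δ^{d/2 + η} ≲ A^{1/(d-1)} τ^η` for every `η ∈ (0, 1)`.

Inserting the value of `α`, both bounds compare `e` with the critical size
`A^{d/(d-1)} τ^{-d/2}`, up to a power of `ε`: the first because `θ > 0`, and the second
because `θ < 1`, if `η = (1 - θ) / 2`. Both hold for `E₁` as well as for `E₂`.
-/

noncomputable section

namespace RestrictedXray

section Lines

variable {V : Type*} [AddCommGroup V] [Module ℝ V]

/-- The point with first coordinate `s` on the line `ℓ = (t, y)`, whose direction is `(1, γ t)`. -/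
def linePoint (γ : ℝ → V) (ℓ : ℝ × V) (s : ℝ) : ℝ × V := (s, ℓ.2 + s • γ ℓ.1)

/-- The line with direction `(1, γ t)` through the point `z`. -/
def lineThrough (γ : ℝ → V) (z : ℝ × V) (t : ℝ) : ℝ × V := (t, z.2 - z.1 • γ t)

/-- The line reached from `ℓ` by moving along it to the point with first coordinate `q.1` and
switching there to the direction with parameter `q.2`. -/
def lineSwitch (γ : ℝ → V) (ℓ : ℝ × V) (q : ℝ × ℝ) : ℝ × V :=
  lineThrough γ (linePoint γ ℓ q.1) q.2

/-- The X-ray transform of the indicator of `E` along lines with directions on `γ`. -/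
def lineMeasure (γ : ℝ → V) (E : Set (ℝ × V)) (ℓ : ℝ × V) : ℝ≥0∞ :=
  volume {s | linePoint γ ℓ s ∈ E}

/-- The dual X-ray transform of the indicator of a set `F` of lines: the measure of the set of
directions of the lines of `F` through `z`. -/
def pencilMeasure (γ : ℝ → V) (F : Set (ℝ × V)) (z : ℝ × V) : ℝ≥0∞ :=
  volume {t | lineThrough γ z t ∈ F}

/-- The points of `E` through which `F` has a pencil of lines of measure at least `b`. -/
def richPoints (γ : ℝ → V) (b : ℝ≥0∞) (E F : Set (ℝ × V)) : Set (ℝ × V) :=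
  E ∩ {z | b ≤ pencilMeasure γ F z}

/-- The lines of `F` that meet the rich points of `E` in measure at least `a`. -/
def richLines (γ : ℝ → V) (a b : ℝ≥0∞) (E F : Set (ℝ × V)) : Set (ℝ × V) :=
  F ∩ {ℓ | a ≤ lineMeasure γ (richPoints γ b E F) ℓ}

/-- The `k`-fold refinement of a set of lines: from each of its lines one can switch `k` times in
a row at rich points. -/
def refinedLines (γ : ℝ → V) (a b : ℝ≥0∞) (E F : Set (ℝ × V)) (k : ℕ) : Set (ℝ × V) :=
  (richLines γ a b E)^[k] F

theorem refinedLines_succ (γ : ℝ → V) (a b : ℝ≥0∞) (E F : Set (ℝ × V)) (k : ℕ) :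
    refinedLines γ a b E F (k + 1) = richLines γ a b E (refinedLines γ a b E F k) :=
  Function.iterate_succ_apply' _ _ _

theorem refinedLines_subset (γ : ℝ → V) (a b : ℝ≥0∞) (E F : Set (ℝ × V)) (k : ℕ) :
    refinedLines γ a b E F k ⊆ F := by
  induction k with
  | zero => exact subset_rfl
  | succ k ih =>
    rw [refinedLines_succ]
    exact Set.inter_subset_left.trans ih

/-- The line reached from `ℓ` after switching successively at the points with first coordinates
`(p i).1` to the directions with parameters `(p i).2`. -/
def pathEnd (γ : ℝ → V) {k : ℕ} (ℓ : ℝ × V) (p : Fin k → ℝ × ℝ) : ℝ × V :=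
  let t : Fin (k + 1) → ℝ := Fin.cons ℓ.1 fun i => (p i).2
  (t (Fin.last k), ℓ.2 + ∑ i : Fin k, (p i).1 • (γ (t i.castSucc) - γ (t i.succ)))

theorem pathEnd_zero (γ : ℝ → V) (ℓ : ℝ × V) (p : Fin 0 → ℝ × ℝ) : pathEnd γ ℓ p = ℓ := by
  simp [pathEnd, Fin.last]

theorem pathEnd_cons (γ : ℝ → V) {k : ℕ} (ℓ : ℝ × V) (q : ℝ × ℝ) (p : Fin k → ℝ × ℝ) :
    pathEnd γ ℓ (Fin.cons q p : Fin (k + 1) → ℝ × ℝ) = pathEnd γ (lineSwitch γ ℓ q) p := by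
  have hcons : (fun i => ((Fin.cons q p : Fin (k + 1) → ℝ × ℝ) i).2) =
      (Fin.cons q.2 fun i => (p i).2 : Fin (k + 1) → ℝ) := by
    ext i
    cases i using Fin.cases <;> rfl
  ext1
  · simp [pathEnd, hcons, ← Fin.succ_last, lineSwitch, lineThrough]
  · simp only [pathEnd, hcons, Fin.sum_univ_succ, Fin.cons_zero, Fin.cons_succ, Fin.castSucc_zero,
      ← Fin.succ_castSucc, lineSwitch, lineThrough, linePoint, smul_sub]
    abel

/-- The parameters at distance at least `δ` from those already used. -/
def farFrom (δ : ℝ) (used : Finset ℝ) : Set ℝ := {t | ∀ u ∈ used, δ ≤ |t - u|}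

/-- The paths of `k` switches from `ℓ` to a line of `F` whose directions lie in `T` and are
`δ`-separated from each other and from the directions in `used`. -/
def separatedPaths (γ : ℝ → V) (T : Set ℝ) (F : Set (ℝ × V)) (δ : ℝ) (k : ℕ) (ℓ : ℝ × V)
    (used : Finset ℝ) : Set (Fin k → ℝ × ℝ) :=
  {p | (∀ i, (p i).2 ∈ T ∩ farFrom δ used) ∧
    (∀ i j, i ≠ j → δ ≤ |(p i).2 - (p j).2|) ∧ pathEnd γ ℓ p ∈ F}

theorem cons_mem_separatedPaths {γ : ℝ → V} {T : Set ℝ} {F : Set (ℝ × V)} {δ : ℝ} {k : ℕ}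
    {ℓ : ℝ × V} {used : Finset ℝ} {q : ℝ × ℝ} (hqT : q.2 ∈ T) (hq : q.2 ∈ farFrom δ used)
    {p : Fin k → ℝ × ℝ}
    (hp : p ∈ separatedPaths γ T F δ k (lineSwitch γ ℓ q) (insert q.2 used)) :
    (Fin.cons q p : Fin (k + 1) → ℝ × ℝ) ∈ separatedPaths γ T F δ (k + 1) ℓ used := by
  obtain ⟨hfar, hsep, hend⟩ := hp
  have hqp (i : Fin k) : δ ≤ |(p i).2 - q.2| := (hfar i).2 q.2 (Finset.mem_insert_self _ _)
  refine ⟨Fin.cases ⟨hqT, hq⟩ fun i => ⟨(hfar i).1, fun u hu =>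
    (hfar i).2 u (Finset.mem_insert_of_mem hu)⟩, ?_, by rwa [pathEnd_cons]⟩
  intro i j hij
  cases i using Fin.cases with
  | zero => cases j using Fin.cases with
    | zero => exact absurd rfl hij
    | succ j => simpa [abs_sub_comm] using hqp j
  | succ i => cases j using Fin.cases with
    | zero => simpa using hqp i
    | succ j => simpa using hsep i j (ne_of_apply_ne Fin.succ hij)

end Lines

section ProductMeasure

theorem volume_setOf_fst_mem_and_mem {X Y Z : Type*} [MeasureSpace X] [MeasureSpace Y]
    [SFinite (volume : Measure Y)] [MeasurableSpace Z] {f : X → Y → Z}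
    (hf : Measurable fun w : X × Y => f w.1 w.2) {A : Set X} (hA : MeasurableSet A) {B : Set Z}
    (hB : MeasurableSet B) :
    volume {w : X × Y | w.1 ∈ A ∧ f w.1 w.2 ∈ B} = ∫⁻ x in A, volume (f x ⁻¹' B) := by
  have hmeas : MeasurableSet {w : X × Y | w.1 ∈ A ∧ f w.1 w.2 ∈ B} :=
    (measurable_fst hA).inter (hf hB)
  rw [Measure.volume_eq_prod, Measure.prod_apply hmeas, ← lintegral_indicator hA]
  refine lintegral_congr fun x => ?_
  by_cases hx : x ∈ A
  · rw [Set.indicator_of_mem hx]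
    congr 1
    ext y
    exact and_iff_right hx
  · rw [Set.indicator_of_notMem hx]
    convert! measure_empty (μ := (volume : Measure Y))
    exact Set.eq_empty_of_forall_notMem fun y hy => hx hy.1

theorem setLIntegral_le_setLIntegral_inter_add {X : Type*} [MeasurableSpace X] {μ : Measure X}
    {A : Set X} (hA : MeasurableSet A) {g : X → ℝ≥0∞} (hg : Measurable g) (b : ℝ≥0∞) :
    ∫⁻ x in A, g x ∂μ ≤ ∫⁻ x in A ∩ {x | b ≤ g x}, g x ∂μ + b * μ A := by
  rw [← lintegral_inter_add_sdiff g A (measurableSet_le measurable_const hg)]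
  gcongr
  calc ∫⁻ x in A \ {x | b ≤ g x}, g x ∂μ ≤ ∫⁻ _ in A \ {x | b ≤ g x}, b ∂μ :=
        setLIntegral_mono' (hA.diff (measurableSet_le measurable_const hg))
          fun x hx => (not_le.1 hx.2).le
    _ ≤ b * μ A := by
        rw [setLIntegral_const]
        gcongr
        exact Set.sdiff_subset

variable {X : Type*} [MeasureSpace X] [SigmaFinite (volume : Measure X)] {k : ℕ}

theorem lintegral_fin_succ_arrow {f : (Fin (k + 1) → X) → ℝ≥0∞} (hf : Measurable f) :
    ∫⁻ p, f p = ∫⁻ q, ∫⁻ p : Fin k → X, f (Fin.cons q p) := by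
  have hcons := (volume_preserving_piFinSuccAbove (fun _ : Fin (k + 1) => X) 0).symm
  rw [← hcons.lintegral_comp hf, Measure.volume_eq_prod, lintegral_prod _ (by fun_prop)]
  simp [MeasurableEquiv.piFinSuccAbove_symm_apply, Fin.insertNthEquiv]

theorem volume_fin_succ_arrow {B : Set (Fin (k + 1) → X)} (hB : MeasurableSet B) :
    volume B = ∫⁻ q, volume {p : Fin k → X | Fin.cons q p ∈ B} := by
  have hcons := (volume_preserving_piFinSuccAbove (fun _ : Fin (k + 1) => X) 0).symm
  rw [← hcons.measure_preimage hB.nullMeasurableSet, Measure.volume_eq_prod,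
    Measure.prod_apply (hcons.measurable hB)]
  simp [MeasurableEquiv.piFinSuccAbove_symm_apply, Fin.insertNthEquiv, Set.preimage]

theorem lintegral_prod_apply_eq_pow {g : X → ℝ≥0∞} (hg : Measurable g) (k : ℕ) :
    ∫⁻ p : Fin k → X, ∏ i, g (p i) = (∫⁻ q, g q) ^ k := by
  induction k with
  | zero => simp [Measure.volume_pi_eq_dirac (default : Fin 0 → X)]
  | succ k ih =>
    have hprod : Measurable fun p : Fin k → X => ∏ i, g (p i) := by fun_prop
    rw [lintegral_fin_succ_arrow (by fun_prop)]
    simp_rw [Fin.prod_univ_succ, Fin.cons_zero, Fin.cons_succ, lintegral_const_mul _ hprod, ih]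
    rw [lintegral_mul_const _ hg, pow_succ']

end ProductMeasure

section FarFrom

theorem measurableSet_farFrom (δ : ℝ) (used : Finset ℝ) : MeasurableSet (farFrom δ used) := by
  simp only [farFrom, Set.ofPred_forall]
  exact used.measurableSet_biInter fun u _ =>
    measurableSet_le measurable_const (measurable_norm.comp (measurable_id.sub_const u))

theorem volume_compl_farFrom_le (δ : ℝ) (used : Finset ℝ) :
    volume (farFrom δ used)ᶜ ≤ ENNReal.ofReal (2 * δ * used.card) := by
  have hcover : (farFrom δ used)ᶜ ⊆ ⋃ u ∈ used, Metric.ball u δ := by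
    intro t ht
    simpa [farFrom, Real.dist_eq] using ht
  calc volume (farFrom δ used)ᶜ ≤ ∑ u ∈ used, volume (Metric.ball u δ) :=
        (measure_mono hcover).trans (measure_biUnion_finset_le _ _)
    _ = ENNReal.ofReal (2 * δ * used.card) := by
        simp only [Real.volume_ball, Finset.sum_const, nsmul_eq_mul]
        rw [mul_comm, ENNReal.ofReal_mul' (Nat.cast_nonneg _), ENNReal.ofReal_natCast]

theorem ofReal_half_le_volume_inter_farFrom {S : Set ℝ} {used : Finset ℝ} {b δ : ℝ}
    (hS : ENNReal.ofReal b ≤ volume S) (hδ : 4 * δ * used.card ≤ b) :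
    ENNReal.ofReal (b / 2) ≤ volume (S ∩ farFrom δ used) := by
  have hsplit : volume S ≤ volume (S ∩ farFrom δ used) + ENNReal.ofReal (b / 2) :=
    calc volume S ≤ volume (S ∩ farFrom δ used) + volume (S \ farFrom δ used) :=
          measure_le_inter_add_sdiff _ _ _
      _ ≤ volume (S ∩ farFrom δ used) + ENNReal.ofReal (b / 2) := by
          gcongr
          refine (measure_mono (Set.sdiff_subset_compl _ _)).trans
            ((volume_compl_farFrom_le δ used).trans (ENNReal.ofReal_le_ofReal ?_))
          linarith
  rcases le_or_gt b 0 with hb | hb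
  · simp [ENNReal.ofReal_of_nonpos (show b / 2 ≤ 0 by linarith)]
  · have hb2 : ENNReal.ofReal b = ENNReal.ofReal (b / 2) + ENNReal.ofReal (b / 2) := by
      rw [← ENNReal.ofReal_add (by linarith) (by linarith), add_halves]
    exact (ENNReal.add_le_add_iff_right ENNReal.ofReal_ne_top).1 (hb2 ▸ hS.trans hsplit)

end FarFrom

section Incidence

variable {V : Type*} [AddCommGroup V] [Module ℝ V] [MeasureSpace V] [MeasurableAdd₂ V]
  [MeasurableSub₂ V] [MeasurableSMul₂ ℝ V] {γ : ℝ → V} (hγ : Measurable γ)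

include hγ

omit [MeasurableSub₂ V] in
theorem measurable_linePoint : Measurable fun w : (ℝ × V) × ℝ => linePoint γ w.1 w.2 := by
  unfold linePoint
  fun_prop

omit [MeasurableAdd₂ V] in
theorem measurable_lineThrough : Measurable fun w : (ℝ × V) × ℝ => lineThrough γ w.1 w.2 := by
  unfold lineThrough
  fun_prop

theorem measurable_lineSwitch (ℓ : ℝ × V) : Measurable (lineSwitch γ ℓ) :=
  (measurable_lineThrough hγ).comp (((measurable_linePoint hγ).comp
    (measurable_const.prodMk measurable_fst)).prodMk measurable_snd)

omit [MeasurableSub₂ V] in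
theorem measurable_lineMeasure {E : Set (ℝ × V)} (hE : MeasurableSet E) :
    Measurable (lineMeasure γ E) :=
  measurable_measure_prodMk_left (measurable_linePoint hγ hE)

omit [MeasurableAdd₂ V] in
theorem measurable_pencilMeasure {F : Set (ℝ × V)} (hF : MeasurableSet F) :
    Measurable (pencilMeasure γ F) :=
  measurable_measure_prodMk_left (measurable_lineThrough hγ hF)

omit [MeasurableAdd₂ V] in
theorem measurableSet_richPoints {E F : Set (ℝ × V)} (hE : MeasurableSet E)
    (hF : MeasurableSet F) (b : ℝ≥0∞) : MeasurableSet (richPoints γ b E F) :=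
  hE.inter (measurableSet_le measurable_const (measurable_pencilMeasure hγ hF))

theorem measurableSet_richLines {E F : Set (ℝ × V)} (hE : MeasurableSet E)
    (hF : MeasurableSet F) (a b : ℝ≥0∞) : MeasurableSet (richLines γ a b E F) :=
  hF.inter (measurableSet_le measurable_const
    (measurable_lineMeasure hγ (measurableSet_richPoints hγ hE hF b)))

theorem measurableSet_refinedLines {E F : Set (ℝ × V)} (hE : MeasurableSet E)
    (hF : MeasurableSet F) (a b : ℝ≥0∞) (k : ℕ) :
    MeasurableSet (refinedLines γ a b E F k) := by
  induction k with
  | zero => exact hF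
  | succ k ih =>
    rw [refinedLines_succ]
    exact measurableSet_richLines hγ hE ih a b

theorem measurable_pathEnd (ℓ : ℝ × V) (k : ℕ) :
    Measurable fun p : Fin k → ℝ × ℝ => pathEnd γ ℓ p := by
  have htime (i : Fin (k + 1)) :
      Measurable fun p : Fin k → ℝ × ℝ => (Fin.cons ℓ.1 fun j => (p j).2 : Fin (k + 1) → ℝ) i := by
    cases i using Fin.cases with
    | zero => exact measurable_const
    | succ j => simpa only [Fin.cons_succ] using (by fun_prop)
  unfold pathEnd
  fun_prop

theorem measurableSet_separatedPaths {T : Set ℝ} {F : Set (ℝ × V)} (hT : MeasurableSet T)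
    (hF : MeasurableSet F) (δ : ℝ) (k : ℕ) (ℓ : ℝ × V) (used : Finset ℝ) :
    MeasurableSet (separatedPaths γ T F δ k ℓ used) := by
  have hdist {g h : (Fin k → ℝ × ℝ) → ℝ} (hg : Measurable g) (hh : Measurable h) :
      MeasurableSet {p | δ ≤ |g p - h p|} :=
    measurableSet_le measurable_const (measurable_norm.comp (hg.sub hh))
  have hfar : MeasurableSet {p : Fin k → ℝ × ℝ | ∀ i, (p i).2 ∈ T ∩ farFrom δ used} := by
    simp only [Set.ofPred_forall]
    exact .iInter fun i => (show Measurable fun p : Fin k → ℝ × ℝ => (p i).2 by fun_prop)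
      (hT.inter (measurableSet_farFrom δ used))
  have hsep : MeasurableSet
      {p : Fin k → ℝ × ℝ | ∀ i j, i ≠ j → δ ≤ |(p i).2 - (p j).2|} := by
    simp only [Set.ofPred_forall]
    exact .iInter fun i => .iInter fun j => .iInter fun _ => hdist (by fun_prop) (by fun_prop)
  exact hfar.inter (hsep.inter (measurable_pathEnd hγ ℓ k hF))

theorem mul_ofReal_half_le_volume_lineSwitch {E F : Set (ℝ × V)} (hE : MeasurableSet E)
    (hF : MeasurableSet F) {ℓ : ℝ × V} {a : ℝ≥0∞} {b δ : ℝ} {used : Finset ℝ}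
    (ha : a ≤ lineMeasure γ (richPoints γ (ENNReal.ofReal b) E F) ℓ)
    (hδ : 4 * δ * used.card ≤ b) :
    a * ENNReal.ofReal (b / 2) ≤
      volume {q : ℝ × ℝ | q.2 ∈ farFrom δ used ∧ lineSwitch γ ℓ q ∈ F} := by
  set D : Set (ℝ × ℝ) := {q | q.2 ∈ farFrom δ used ∧ lineSwitch γ ℓ q ∈ F}
  have hD : MeasurableSet D :=
    (measurable_snd (measurableSet_farFrom δ used)).inter (measurable_lineSwitch hγ ℓ hF)
  set P : Set ℝ := linePoint γ ℓ ⁻¹' richPoints γ (ENNReal.ofReal b) E F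
  have hP : MeasurableSet P :=
    ((measurable_linePoint hγ).comp measurable_prodMk_left)
      (measurableSet_richPoints hγ hE hF _)
  rw [Measure.volume_eq_prod, Measure.prod_apply hD]
  calc a * ENNReal.ofReal (b / 2) ≤ ∫⁻ _ in P, ENNReal.ofReal (b / 2) := by
        rw [setLIntegral_const, mul_comm]
        gcongr
        exact ha
    _ ≤ ∫⁻ s in P, volume (Prod.mk s ⁻¹' D) :=
        setLIntegral_mono' hP fun s hs =>
          (ofReal_half_le_volume_inter_farFrom hs.2 hδ).trans (measure_mono fun _ ht => ht.symm)
    _ ≤ ∫⁻ s, volume (Prod.mk s ⁻¹' D) := setLIntegral_le_lintegral _ _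

theorem pow_le_volume_separatedPaths {T : Set ℝ} {E F : Set (ℝ × V)} (hT : MeasurableSet T)
    (hE : MeasurableSet E) (hF : MeasurableSet F) (hFT : ∀ ℓ ∈ F, ℓ.1 ∈ T) {a : ℝ≥0∞} {b δ : ℝ}
    (hδ0 : 0 ≤ δ) (k : ℕ) {ℓ : ℝ × V} {used : Finset ℝ}
    (hℓ : ℓ ∈ refinedLines γ a (ENNReal.ofReal b) E F k) (hδ : 4 * δ * (used.card + k) ≤ b) :
    (a * ENNReal.ofReal (b / 2)) ^ k ≤ volume (separatedPaths γ T F δ k ℓ used) := by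
  induction k generalizing ℓ used with
  | zero =>
    have huniv : separatedPaths γ T F δ 0 ℓ used = Set.univ :=
      Set.eq_univ_of_forall fun p =>
        ⟨fun i => i.elim0, fun i => i.elim0, by rwa [pathEnd_zero]⟩
    simp [huniv, Measure.volume_pi_eq_dirac (default : Fin 0 → ℝ × ℝ)]
  | succ k ih =>
    push_cast at hδ
    rw [refinedLines_succ] at hℓ
    set Fk := refinedLines γ a (ENNReal.ofReal b) E F k
    have hFk : MeasurableSet Fk := measurableSet_refinedLines hγ hE hF _ _ k
    set D : Set (ℝ × ℝ) := {q | q.2 ∈ farFrom δ used ∧ lineSwitch γ ℓ q ∈ Fk}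
    have hD : MeasurableSet D :=
      (measurable_snd (measurableSet_farFrom δ used)).inter (measurable_lineSwitch hγ ℓ hFk)
    have hDvol : a * ENNReal.ofReal (b / 2) ≤ volume D :=
      mul_ofReal_half_le_volume_lineSwitch hγ hE hFk hℓ.2
        (le_trans (by gcongr; linarith) hδ)
    have hrest (q : ℝ × ℝ) (hq : q ∈ D) : (a * ENNReal.ofReal (b / 2)) ^ k ≤
        volume {p : Fin k → ℝ × ℝ | Fin.cons q p ∈ separatedPaths γ T F δ (k + 1) ℓ used} := by
      have hcard : ((insert q.2 used).card : ℝ) ≤ used.card + 1 := by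
        exact_mod_cast Finset.card_insert_le q.2 used
      refine (ih (used := insert q.2 used) hq.2 (hδ.trans' ?_)).trans (measure_mono fun p hp => ?_)
      · exact mul_le_mul_of_nonneg_left (by linarith) (by positivity)
      · exact cons_mem_separatedPaths (hFT _ (refinedLines_subset _ _ _ _ _ _ hq.2)) hq.1 hp
    rw [volume_fin_succ_arrow (measurableSet_separatedPaths hγ hT hF δ _ ℓ used)]
    calc (a * ENNReal.ofReal (b / 2)) ^ (k + 1)
        ≤ ∫⁻ _ in D, (a * ENNReal.ofReal (b / 2)) ^ k := by
          rw [setLIntegral_const, pow_succ]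
          gcongr
      _ ≤ ∫⁻ q in D, volume {p : Fin k → ℝ × ℝ |
            Fin.cons q p ∈ separatedPaths γ T F δ (k + 1) ℓ used} := setLIntegral_mono' hD hrest
      _ ≤ _ := setLIntegral_le_lintegral _ _

variable [SFinite (volume : Measure V)] [(volume : Measure V).IsAddRightInvariant]

omit [MeasurableSub₂ V] in
theorem measurePreserving_linePoint :
    MeasurePreserving fun w : (ℝ × V) × ℝ => (linePoint γ w.1 w.2, w.1.1) := by
  have shuffle : MeasurePreserving fun w : (ℝ × V) × ℝ => ((w.1.1, w.2), w.1.2) :=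
    volume_preserving_prodAssoc.symm.comp
      (((MeasurePreserving.id volume).prod Measure.measurePreserving_swap).comp
        volume_preserving_prodAssoc)
  have unshuffle : MeasurePreserving fun w : (ℝ × ℝ) × V => ((w.1.1, w.2), w.1.2) :=
    volume_preserving_prodAssoc.symm.comp
      (((MeasurePreserving.id volume).prod Measure.measurePreserving_swap).comp
        volume_preserving_prodAssoc)
  have shear : MeasurePreserving fun w : (ℝ × ℝ) × V => (w.1.swap, w.2 + w.1.2 • γ w.1.1) :=
    Measure.measurePreserving_swap.skew_product (g := fun (w : ℝ × ℝ) y => y + w.2 • γ w.1)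
      (by fun_prop) (ae_of_all _ fun w => (measurePreserving_add_right volume _).map_eq)
  exact unshuffle.comp (shear.comp shuffle)

theorem setLIntegral_lineMeasure {E F : Set (ℝ × V)} (hE : MeasurableSet E)
    (hF : MeasurableSet F) :
    ∫⁻ ℓ in F, lineMeasure γ E ℓ = ∫⁻ z in E, pencilMeasure γ F z :=
  calc ∫⁻ ℓ in F, lineMeasure γ E ℓ
      = volume {w : (ℝ × V) × ℝ | w.1 ∈ F ∧ linePoint γ w.1 w.2 ∈ E} :=
        (volume_setOf_fst_mem_and_mem (measurable_linePoint hγ) hF hE).symm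
    _ = volume {w : (ℝ × V) × ℝ | w.1 ∈ E ∧ lineThrough γ w.1 w.2 ∈ F} := by
        have hmeas : MeasurableSet {w : (ℝ × V) × ℝ | w.1 ∈ E ∧ lineThrough γ w.1 w.2 ∈ F} :=
          (measurable_fst hE).inter (measurable_lineThrough hγ hF)
        rw [← (measurePreserving_linePoint hγ).measure_preimage hmeas.nullMeasurableSet]
        congr 1
        ext w
        simp [linePoint, lineThrough, and_comm]
    _ = ∫⁻ z in E, pencilMeasure γ F z :=
        volume_setOf_fst_mem_and_mem (measurable_lineThrough hγ) hE hF

omit [MeasurableSub₂ V] in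
theorem ae_ae_linePoint {P : ℝ × V → Prop} (hP : ∀ᵐ z, P z) :
    ∀ᵐ ℓ : ℝ × V, ∀ᵐ s : ℝ, P (linePoint γ ℓ s) :=
  Measure.ae_ae_of_ae_prod ((measurePreserving_linePoint hγ).quasiMeasurePreserving.ae
    (Measure.quasiMeasurePreserving_fst.ae hP))

theorem mul_volume_le_volume_mul {E F : Set (ℝ × V)} {T : Set ℝ} (hE : MeasurableSet E)
    (hF : MeasurableSet F) (hFT : ∀ ℓ ∈ F, ℓ.1 ∈ T) {a : ℝ≥0∞}
    (ha : ∀ ℓ ∈ F, a ≤ lineMeasure γ E ℓ) : a * volume F ≤ volume T * volume E :=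
  calc a * volume F = ∫⁻ _ in F, a := (setLIntegral_const _ _).symm
    _ ≤ ∫⁻ ℓ in F, lineMeasure γ E ℓ := setLIntegral_mono' hF ha
    _ = ∫⁻ z in E, pencilMeasure γ F z := setLIntegral_lineMeasure hγ hE hF
    _ ≤ ∫⁻ _ in E, volume T := lintegral_mono fun _ => measure_mono fun _ ht => hFT _ ht
    _ = volume T * volume E := setLIntegral_const _ _

theorem setLIntegral_lineMeasure_le_richLines_add {E F : Set (ℝ × V)} (hE : MeasurableSet E)
    (hF : MeasurableSet F) (a b : ℝ≥0∞) :
    ∫⁻ ℓ in F, lineMeasure γ E ℓ ≤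
      (∫⁻ ℓ in richLines γ a b E F, lineMeasure γ E ℓ) + (a * volume F + b * volume E) := by
  have hR := measurableSet_richPoints hγ hE hF b
  calc ∫⁻ ℓ in F, lineMeasure γ E ℓ = ∫⁻ z in E, pencilMeasure γ F z :=
        setLIntegral_lineMeasure hγ hE hF
    _ ≤ (∫⁻ z in richPoints γ b E F, pencilMeasure γ F z) + b * volume E :=
        setLIntegral_le_setLIntegral_inter_add hE (measurable_pencilMeasure hγ hF) b
    _ = (∫⁻ ℓ in F, lineMeasure γ (richPoints γ b E F) ℓ) + b * volume E := by
        rw [setLIntegral_lineMeasure hγ hR hF]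
    _ ≤ (∫⁻ ℓ in richLines γ a b E F, lineMeasure γ (richPoints γ b E F) ℓ) + a * volume F +
          b * volume E := by
        gcongr
        exact setLIntegral_le_setLIntegral_inter_add hF (measurable_lineMeasure hγ hR) a
    _ ≤ (∫⁻ ℓ in richLines γ a b E F, lineMeasure γ E ℓ) + (a * volume F + b * volume E) := by
        rw [add_assoc]
        gcongr with ℓ
        exact measure_mono (Set.preimage_mono Set.inter_subset_left)

theorem setLIntegral_lineMeasure_le_refinedLines_add {E F : Set (ℝ × V)} (hE : MeasurableSet E)
    (hF : MeasurableSet F) (a b : ℝ≥0∞) (k : ℕ) :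
    ∫⁻ ℓ in F, lineMeasure γ E ℓ ≤
      (∫⁻ ℓ in refinedLines γ a b E F k, lineMeasure γ E ℓ) +
        k * (a * volume F + b * volume E) := by
  induction k with
  | zero => simp [refinedLines]
  | succ k ih =>
    have hrefine := setLIntegral_lineMeasure_le_richLines_add hγ hE
      (measurableSet_refinedLines hγ hE hF a b k) a b
    rw [← refinedLines_succ] at hrefine
    calc ∫⁻ ℓ in F, lineMeasure γ E ℓ
        ≤ (∫⁻ ℓ in refinedLines γ a b E F (k + 1), lineMeasure γ E ℓ) +
            (a * volume F + b * volume E) + k * (a * volume F + b * volume E) := by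
          refine ih.trans ?_
          gcongr
          refine hrefine.trans ?_
          gcongr
          exact refinedLines_subset γ a b E F k
      _ = (∫⁻ ℓ in refinedLines γ a b E F (k + 1), lineMeasure γ E ℓ) +
            (k + 1 : ℕ) * (a * volume F + b * volume E) := by
          push_cast
          ring

theorem refinedLines_nonempty {E F : Set (ℝ × V)} (hE : MeasurableSet E) (hF : MeasurableSet F)
    {a b : ℝ≥0∞} {k : ℕ} (h : k * (a * volume F + b * volume E) < ∫⁻ ℓ in F, lineMeasure γ E ℓ) :
    (refinedLines γ a b E F k).Nonempty := by
  by_contra hempty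
  have hle := setLIntegral_lineMeasure_le_refinedLines_add hγ hE hF a b k
  rw [Set.not_nonempty_iff_eq_empty.1 hempty, Measure.restrict_empty, lintegral_zero_measure,
    zero_add] at hle
  exact h.not_ge hle

end Incidence

section MomentCurve

theorem volume_setOf_add_sum_smul_mem {ι : Type*} [Fintype ι] [DecidableEq ι] {w : ι → ι → ℝ}
    (hw : (Matrix.of w).det ≠ 0) (y : ι → ℝ) (B : Set (ι → ℝ)) :
    volume {s : ι → ℝ | y + ∑ i, s i • w i ∈ B} =
      ENNReal.ofReal |(Matrix.of w).det|⁻¹ * volume B := by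
  have hdet : LinearMap.det (Matrix.toLin' (Matrix.of w).transpose) = (Matrix.of w).det := by
    rw [LinearMap.det_toLin', Matrix.det_transpose]
  have hpre : {s : ι → ℝ | y + ∑ i, s i • w i ∈ B} =
      Matrix.toLin' (Matrix.of w).transpose ⁻¹' ((fun x => y + x) ⁻¹' B) := by
    ext s
    simp [Matrix.mulVec_transpose, Matrix.vecMul_eq_sum]
    rfl
  rw [hpre, Measure.addHaar_preimage_linearMap _ (hdet ▸ hw), measure_preimage_add, hdet, abs_inv]

theorem det_momentCurve_sub (d : ℕ) (v : Fin (d - 1 + 1) → ℝ) :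
    (Matrix.of fun i : Fin (d - 1) => momentCurve d (v i.succ) - momentCurve d (v i.castSucc)).det =
      ∏ i, ∏ j ∈ Finset.Ioi i, (v j - v i) := by
  let rowDiff : Matrix (Fin (d - 1 + 1)) (Fin (d - 1 + 1)) ℝ := fun i j =>
    Fin.cases (v 0 ^ (j : ℕ)) (fun k => v k.succ ^ (j : ℕ) - v k.castSucc ^ (j : ℕ)) i
  have hrow : (Matrix.vandermonde v).det = rowDiff.det :=
    Matrix.det_eq_of_forall_row_eq_smul_add_pred (fun _ => 1)
      (fun j => by simp [rowDiff, Matrix.vandermonde])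
      (fun i j => by simp [rowDiff, Matrix.vandermonde])
  rw [← Matrix.det_vandermonde, hrow, Matrix.det_succ_column_zero, Fin.sum_univ_succ,
    Finset.sum_eq_zero fun i _ => by simp [rowDiff]]
  simp only [rowDiff, Fin.cases_zero, Fin.val_zero, pow_zero, one_mul, add_zero]
  congr 1

theorem abs_det_momentCurve_sub (d : ℕ) (v : Fin (d - 1 + 1) → ℝ) :
    |(Matrix.of fun i : Fin (d - 1) =>
        momentCurve d (v i.castSucc) - momentCurve d (v i.succ)).det| =
      ∏ i, ∏ j ∈ Finset.Ioi i, |v j - v i| := by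
  have hneg : (Matrix.of fun i : Fin (d - 1) =>
        momentCurve d (v i.castSucc) - momentCurve d (v i.succ)) =
      -Matrix.of fun i : Fin (d - 1) =>
        momentCurve d (v i.succ) - momentCurve d (v i.castSucc) := by
    ext i j
    simp
  rw [hneg, Matrix.det_neg, abs_mul, abs_neg_one_pow, one_mul, det_momentCurve_sub]
  simp only [Finset.abs_prod]

theorem pow_le_prod_abs_sub {n : ℕ} {δ : ℝ} (hδ : 0 < δ) {t : Fin n → ℝ}
    (ht : ∀ i j, i ≠ j → δ ≤ |t i - t j|) :
    (δ ^ (((n : ℝ) - 1) / 2)) ^ n ≤ ∏ i, ∏ j ∈ Finset.Ioi i, |t j - t i| := by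
  have hpairs : ∑ i : Fin n, (Finset.Ioi i).card = n.choose 2 := by
    simp_rw [Fin.card_Ioi]
    rw [Fin.sum_univ_eq_sum_range (fun i => n - 1 - i) n, Finset.sum_range_reflect (fun i => i),
      Finset.sum_range_id, Nat.choose_two_right]
  calc (δ ^ (((n : ℝ) - 1) / 2)) ^ n = δ ^ n.choose 2 := by
        rw [← Real.rpow_mul_natCast hδ.le, ← Real.rpow_natCast, Nat.cast_choose_two]
        congr 1
        ring
    _ = ∏ i : Fin n, ∏ _j ∈ Finset.Ioi i, δ := by
        simp only [Finset.prod_const, Finset.prod_pow_eq_pow_sum, hpairs]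
    _ ≤ ∏ i, ∏ j ∈ Finset.Ioi i, |t j - t i| :=
        Finset.prod_le_prod (fun _ _ => by positivity) fun i _ =>
          Finset.prod_le_prod (fun _ _ => hδ.le) fun j hj => ht j i (Finset.mem_Ioi.1 hj).ne'

theorem rpow_mul_inv_rpow_sub_one_le {δ x η : ℝ} (hδ : 0 < δ) (hx : δ ≤ x) (hη : 0 ≤ η) :
    δ ^ η * (x ^ (η - 1))⁻¹ ≤ x := by
  have hx0 : 0 < x := hδ.trans_le hx
  calc δ ^ η * (x ^ (η - 1))⁻¹ ≤ x ^ η * (x ^ (η - 1))⁻¹ := by gcongr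
    _ = x := by rw [← Real.rpow_neg hx0.le, ← Real.rpow_add hx0]; simp

theorem le_abs_det_momentCurve_sub {d : ℕ} {δ η t₀ : ℝ} (hδ : 0 < δ) (hη : 0 ≤ η)
    {t : Fin (d - 1) → ℝ} (ht₀ : ∀ i, δ ≤ |t i - t₀|) (ht : ∀ i j, i ≠ j → δ ≤ |t i - t j|)
    {v : Fin (d - 1 + 1) → ℝ} (hv : v = Fin.cons t₀ t) :
    (δ ^ (d / 2 - 1 + η)) ^ (d - 1) * (∏ i, |t i - t₀| ^ (η - 1))⁻¹ ≤
      |(Matrix.of fun i : Fin (d - 1) =>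
        momentCurve d (v i.castSucc) - momentCurve d (v i.succ)).det| := by
  have hexp : (δ ^ ((d : ℝ) / 2 - 1)) ^ (d - 1) =
      (δ ^ ((((d - 1 : ℕ) : ℝ) - 1) / 2)) ^ (d - 1) := by
    rcases d with _ | d
    · rfl
    · push_cast
      ring_nf
  have hstart : (δ ^ η) ^ (d - 1) * (∏ i, |t i - t₀| ^ (η - 1))⁻¹ ≤ ∏ i, |t i - t₀| := by
    rw [← Finset.prod_inv_distrib, ← Fin.prod_const, ← Finset.prod_mul_distrib]
    exact Finset.prod_le_prod (fun _ _ => by positivity) fun i _ =>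
      rpow_mul_inv_rpow_sub_one_le hδ (ht₀ i) hη
  calc (δ ^ (d / 2 - 1 + η)) ^ (d - 1) * (∏ i, |t i - t₀| ^ (η - 1))⁻¹
      = ((δ ^ η) ^ (d - 1) * (∏ i, |t i - t₀| ^ (η - 1))⁻¹) *
          (δ ^ ((((d - 1 : ℕ) : ℝ) - 1) / 2)) ^ (d - 1) := by
        rw [Real.rpow_add hδ, mul_pow, hexp]
        ring
    _ ≤ (∏ i, |t i - t₀|) * ∏ i, ∏ j ∈ Finset.Ioi i, |t j - t i| := by
        gcongr
        exact pow_le_prod_abs_sub hδ ht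
    _ = _ := by
        rw [abs_det_momentCurve_sub, Fin.prod_univ_succ, Fin.prod_Ioi_zero]
        simp_rw [hv, Fin.prod_Ioi_succ, Fin.cons_zero, Fin.cons_succ]

theorem volume_pathEnd_preimage_le {d : ℕ} {F : Set (Space d)} {A : ℝ≥0∞} {δ η : ℝ} {ℓ : Space d}
    (hA : ∀ u, volume (Prod.mk u ⁻¹' F) ≤ A) (hδ : 0 < δ) (hη : 0 ≤ η) {t : Fin (d - 1) → ℝ}
    (ht₀ : ∀ i, δ ≤ |t i - ℓ.1|) (ht : ∀ i j, i ≠ j → δ ≤ |t i - t j|) :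
    volume {s : Fin (d - 1) → ℝ | pathEnd (momentCurve d) ℓ (fun i => (s i, t i)) ∈ F} ≤
      A * ENNReal.ofReal ((δ ^ (d / 2 - 1 + η))⁻¹ ^ (d - 1)) *
        ∏ i, ENNReal.ofReal (|t i - ℓ.1| ^ (η - 1)) := by
  set v : Fin (d - 1 + 1) → ℝ := Fin.cons ℓ.1 t with hv
  set Δ : ℝ := (Matrix.of fun i : Fin (d - 1) =>
    momentCurve d (v i.castSucc) - momentCurve d (v i.succ)).det
  have hpos : 0 < ∏ i, |t i - ℓ.1| ^ (η - 1) :=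
    Finset.prod_pos fun i _ => Real.rpow_pos_of_pos (hδ.trans_le (ht₀ i)) _
  have hΔ := le_abs_det_momentCurve_sub hδ hη ht₀ ht hv
  have hΔ0 : Δ ≠ 0 := abs_pos.1 (lt_of_lt_of_le (by positivity) hΔ)
  calc volume {s : Fin (d - 1) → ℝ | pathEnd (momentCurve d) ℓ (fun i => (s i, t i)) ∈ F}
      = ENNReal.ofReal |Δ|⁻¹ * volume (Prod.mk (v (Fin.last _)) ⁻¹' F) :=
        volume_setOf_add_sum_smul_mem hΔ0 ℓ.2 (Prod.mk (v (Fin.last _)) ⁻¹' F)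
    _ ≤ ENNReal.ofReal ((δ ^ (d / 2 - 1 + η))⁻¹ ^ (d - 1) *
          ∏ i, |t i - ℓ.1| ^ (η - 1)) * A := by
        gcongr
        · rw [inv_pow, ← inv_inv (∏ i, _), ← mul_inv]
          exact inv_anti₀ (by positivity) hΔ
        · exact hA _
    _ = _ := by
        rw [ENNReal.ofReal_mul (by positivity),
          ENNReal.ofReal_prod_of_nonneg fun i _ => by positivity]
        ring

theorem lintegral_indicator_Ioo_rpow {τ η : ℝ} (hτ : 0 ≤ τ) (hη : 0 < η) :
    ∫⁻ x : ℝ, (Set.Ioo 0 τ).indicator (fun x => ENNReal.ofReal (x ^ (η - 1))) x =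
      ENNReal.ofReal (τ ^ η / η) := by
  have hint : IntegrableOn (fun x : ℝ => x ^ (η - 1)) (Set.Ioo 0 τ) :=
    ((intervalIntegrable_iff_integrableOn_Ioc_of_le hτ).1
      (intervalIntegral.intervalIntegrable_rpow' (by linarith))).mono_set Set.Ioo_subset_Ioc_self
  have hnonneg : ∀ᵐ x ∂volume.restrict (Set.Ioo 0 τ), 0 ≤ x ^ (η - 1) :=
    (ae_restrict_iff' measurableSet_Ioo).2 (.of_forall fun x hx => Real.rpow_nonneg hx.1.le _)
  rw [lintegral_indicator measurableSet_Ioo, ← ofReal_integral_eq_lintegral_ofReal hint hnonneg,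
    ← integral_Ioc_eq_integral_Ioo, ← intervalIntegral.integral_of_le hτ,
    integral_rpow (Or.inl (by linarith))]
  simp [Real.zero_rpow hη.ne']

theorem setLIntegral_abs_sub_rpow_le {T : Set ℝ} {τ η : ℝ} (hτ : 0 < τ)
    (hT : volume T ≤ ENNReal.ofReal τ) (hη0 : 0 < η) (hη1 : η < 1) (t₀ : ℝ) :
    ∫⁻ u in T, ENNReal.ofReal (|u - t₀| ^ (η - 1)) ≤ ENNReal.ofReal ((2 / η + 1) * τ ^ η) := by
  let near : ℝ → ℝ≥0∞ := (Set.Ioo 0 τ).indicator fun x => ENNReal.ofReal (x ^ (η - 1))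
  have hnear : Measurable near := Measurable.indicator (by fun_prop) measurableSet_Ioo
  have hle (u : ℝ) : ENNReal.ofReal (|u - t₀| ^ (η - 1)) ≤
      near (u - t₀) + near (t₀ - u) + ENNReal.ofReal (τ ^ (η - 1)) := by
    rcases le_or_gt τ |u - t₀| with hfar | hclose
    · exact le_add_left
        (ENNReal.ofReal_le_ofReal (Real.rpow_le_rpow_of_nonpos hτ hfar (by linarith)))
    · have hnear_eq {x : ℝ} (h0 : 0 < x) (hx : x < τ) : near x = ENNReal.ofReal (x ^ (η - 1)) :=
        Set.indicator_of_mem (Set.mem_Ioo.2 ⟨h0, hx⟩) _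
      rcases lt_trichotomy (u - t₀) 0 with h0 | h0 | h0
      · rw [abs_of_neg h0, neg_sub] at hclose ⊢
        rw [← hnear_eq (by linarith) hclose]
        exact le_add_right le_add_self
      · simp [h0, Real.zero_rpow (show η - 1 ≠ 0 by linarith)]
      · rw [abs_of_pos h0] at hclose ⊢
        rw [← hnear_eq h0 hclose]
        exact le_add_right le_self_add
  calc ∫⁻ u in T, ENNReal.ofReal (|u - t₀| ^ (η - 1))
      ≤ ∫⁻ u in T, (near (u - t₀) + near (t₀ - u) + ENNReal.ofReal (τ ^ (η - 1))) :=
        lintegral_mono hle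
    _ ≤ (∫⁻ u, near (u - t₀)) + (∫⁻ u, near (t₀ - u)) +
          ENNReal.ofReal (τ ^ (η - 1)) * volume T := by
        rw [lintegral_add_right _ measurable_const, setLIntegral_const,
          lintegral_add_left (by fun_prop)]
        gcongr <;> exact Measure.restrict_le_self
    _ ≤ ENNReal.ofReal (τ ^ η / η) + ENNReal.ofReal (τ ^ η / η) +
          ENNReal.ofReal (τ ^ (η - 1)) * ENNReal.ofReal τ := by
        rw [lintegral_sub_right_eq_self, lintegral_sub_left_eq_self,
          lintegral_indicator_Ioo_rpow hτ.le hη0]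
        gcongr
    _ = ENNReal.ofReal ((2 / η + 1) * τ ^ η) := by
        have hτη : τ ^ (η - 1) * τ = τ ^ η := by
          rw [Real.rpow_sub_one hτ.ne', div_mul_cancel₀ _ hτ.ne']
        rw [← ENNReal.ofReal_mul (by positivity), ← ENNReal.ofReal_add (by positivity)
          (by positivity), ← ENNReal.ofReal_add (by positivity) (by positivity), hτη]
        congr 1
        ring

theorem measurable_momentCurve (d : ℕ) : Measurable (momentCurve d) := by
  unfold momentCurve
  fun_prop

theorem volume_separatedPaths_le {d : ℕ} {T : Set ℝ} {F : Set (Space d)} (hT : MeasurableSet T)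
    (hF : MeasurableSet F) {A : ℝ≥0∞} {δ τ η : ℝ} (hA : ∀ u, volume (Prod.mk u ⁻¹' F) ≤ A)
    (hδ : 0 < δ) (hτ : 0 < τ) (hTτ : volume T ≤ ENNReal.ofReal τ) (hη0 : 0 < η) (hη1 : η < 1)
    (ℓ : Space d) :
    volume (separatedPaths (momentCurve d) T F δ (d - 1) ℓ {ℓ.1}) ≤
      A * ENNReal.ofReal (((δ ^ (d / 2 - 1 + η))⁻¹ * ((2 / η + 1) * τ ^ η)) ^ (d - 1)) := by
  set P := separatedPaths (momentCurve d) T F δ (d - 1) ℓ {ℓ.1}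
  set K : ℝ := (δ ^ (d / 2 - 1 + η))⁻¹
  have hP : MeasurableSet P :=
    measurableSet_separatedPaths (measurable_momentCurve d) hT hF δ _ ℓ _
  let g : ℝ → ℝ≥0∞ := T.indicator fun u => ENNReal.ofReal (|u - ℓ.1| ^ (η - 1))
  have hg : Measurable g :=
    Measurable.indicator (by simp_rw [← Real.norm_eq_abs]; fun_prop) hT
  have hfibre (t : Fin (d - 1) → ℝ) :
      volume {s : Fin (d - 1) → ℝ | (fun i => (s i, t i)) ∈ P} ≤
        A * ENNReal.ofReal (K ^ (d - 1)) * ∏ i, g (t i) := by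
    by_cases ht : (∀ i, t i ∈ T ∩ farFrom δ {ℓ.1}) ∧ ∀ i j, i ≠ j → δ ≤ |t i - t j|
    · rw [Finset.prod_congr rfl fun i _ => Set.indicator_of_mem (ht.1 i).1 _]
      exact (measure_mono fun s hs => hs.2.2).trans (volume_pathEnd_preimage_le hA hδ hη0.le
        (fun i => (ht.1 i).2 ℓ.1 (Finset.mem_singleton_self _)) ht.2)
    · have hempty : {s : Fin (d - 1) → ℝ | (fun i => (s i, t i)) ∈ P} = ∅ :=
        Set.eq_empty_of_forall_notMem fun s hs => ht ⟨hs.1, hs.2.1⟩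
      simp [hempty]
  have hmp := (volume_measurePreserving_arrowProdEquivProdArrow ℝ ℝ (Fin (d - 1))).symm
  rw [← hmp.measure_preimage hP.nullMeasurableSet, Measure.volume_eq_prod,
    Measure.prod_apply_symm (hmp.measurable hP)]
  calc _ ≤ ∫⁻ t : Fin (d - 1) → ℝ, A * ENNReal.ofReal (K ^ (d - 1)) * ∏ i, g (t i) :=
        lintegral_mono hfibre
    _ = A * ENNReal.ofReal (K ^ (d - 1)) * (∫⁻ u, g u) ^ (d - 1) := by
        rw [lintegral_const_mul _ (by fun_prop), lintegral_prod_apply_eq_pow hg]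
    _ ≤ A * ENNReal.ofReal (K ^ (d - 1)) * ENNReal.ofReal ((2 / η + 1) * τ ^ η) ^ (d - 1) := by
        rw [lintegral_indicator hT]
        gcongr
        exact setLIntegral_abs_sub_rpow_le hτ hTτ hη0 hη1 _
    _ = A * ENNReal.ofReal ((K * ((2 / η + 1) * τ ^ η)) ^ (d - 1)) := by
        rw [← ENNReal.ofReal_pow (by positivity), mul_assoc, ← ENNReal.ofReal_mul (by positivity),
          ← mul_pow]

end MomentCurve

section LineFamily

/-- A measurable family of lines with directions in `S`, where `|S| ≤ τ`, and with at most `A`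
lines in each direction. The set `F` of the theorem is such a family up to a null set, and all that
is used of it is this structure together with a lower bound for its measure. -/
structure IsLineFamily {d : ℕ} (S : Set ℝ) (A τ : ℝ) (G : Set (Space d)) : Prop where
  measurableSet : MeasurableSet G
  measurableSet_directions : MeasurableSet S
  fst_mem : ∀ ℓ ∈ G, ℓ.1 ∈ S
  volume_directions_le : volume S ≤ ENNReal.ofReal τ
  volume_fibre_le : ∀ t, volume (Prod.mk t ⁻¹' G) ≤ ENNReal.ofReal A

variable {d : ℕ} {S : Set ℝ} {A τ : ℝ} {E G : Set (Space d)}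

theorem IsLineFamily.mono {G' : Set (Space d)} (hG : IsLineFamily S A τ G)
    (hG' : MeasurableSet G') (hsub : G' ⊆ G) : IsLineFamily S A τ G' where
  measurableSet := hG'
  measurableSet_directions := hG.measurableSet_directions
  fst_mem ℓ hℓ := hG.fst_mem ℓ (hsub hℓ)
  volume_directions_le := hG.volume_directions_le
  volume_fibre_le t := (measure_mono (Set.preimage_mono hsub)).trans (hG.volume_fibre_le t)

theorem IsLineFamily.volume_lt_top (hG : IsLineFamily S A τ G) : volume G < ∞ := by
  have hfibre (t : ℝ) : volume (Prod.mk t ⁻¹' G) ≤ S.indicator (fun _ => ENNReal.ofReal A) t := by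
    by_cases ht : t ∈ S
    · simpa only [Set.indicator_of_mem ht] using hG.volume_fibre_le t
    · have hempty : Prod.mk t ⁻¹' G = ∅ :=
        Set.eq_empty_of_forall_notMem fun y hy => ht (hG.fst_mem _ hy)
      simp [hempty]
  calc volume G ≤ ∫⁻ t, S.indicator (fun _ => ENNReal.ofReal A) t := by
        rw [Measure.volume_eq_prod, Measure.prod_apply hG.measurableSet]
        exact lintegral_mono hfibre
    _ = ENNReal.ofReal A * volume S := lintegral_indicator_const hG.measurableSet_directions _
    _ < ∞ := ENNReal.mul_lt_top ENNReal.ofReal_lt_top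
        (hG.volume_directions_le.trans_lt ENNReal.ofReal_lt_top)

variable {α e g : ℝ}

theorem IsLineFamily.mul_le_mul (hG : IsLineFamily S A τ G) (hE : MeasurableSet E)
    (hα : 0 < α) (he : 0 < e) (hτ : 0 < τ) (hEe : volume E ≤ ENNReal.ofReal e)
    (hGg : ENNReal.ofReal g ≤ volume G)
    (hGE : ∀ ℓ ∈ G, ENNReal.ofReal α ≤ lineMeasure (momentCurve d) E ℓ) : α * g ≤ τ * e := by
  have h : ENNReal.ofReal α * ENNReal.ofReal g ≤ ENNReal.ofReal τ * ENNReal.ofReal e :=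
    calc _ ≤ ENNReal.ofReal α * volume G := by gcongr
      _ ≤ volume S * volume E :=
        mul_volume_le_volume_mul (measurable_momentCurve d) hE hG.measurableSet hG.fst_mem hGE
      _ ≤ _ := mul_le_mul' hG.volume_directions_le hEe
  rwa [← ENNReal.ofReal_mul hα.le, ← ENNReal.ofReal_mul hτ.le,
    ENNReal.ofReal_le_ofReal_iff (by positivity)] at h

theorem IsLineFamily.refinedLines_nonempty (hG : IsLineFamily S A τ G) (hE : MeasurableSet E)
    {n : ℕ} (hn : n ≠ 0) (hα : 0 < α) (he : 0 < e) (hg : 0 < g)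
    (hEe : volume E ≤ ENNReal.ofReal e) (hGg : ENNReal.ofReal g ≤ volume G)
    (hGE : ∀ ℓ ∈ G, ENNReal.ofReal α ≤ lineMeasure (momentCurve d) E ℓ) :
    (refinedLines (momentCurve d) (ENNReal.ofReal (α / (4 * n)))
      (ENNReal.ofReal (α * g / e / (4 * n))) E G n).Nonempty := by
  refine RestrictedXray.refinedLines_nonempty (measurable_momentCurve d) hE hG.measurableSet ?_
  set v := volume.real G
  have hv : volume G = ENNReal.ofReal v :=
    (ENNReal.ofReal_toReal hG.volume_lt_top.ne).symm
  have hgv : g ≤ v := (ENNReal.ofReal_le_iff_le_toReal hG.volume_lt_top.ne).1 hGg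
  have hv0 : 0 < v := hg.trans_le hgv
  have hhalf : n * (α / (4 * n) * v + α * g / e / (4 * n) * e) ≤ α * v / 2 :=
    calc _ = α * v / 4 + α * g / 4 := by field_simp
      _ ≤ α * v / 4 + α * v / 4 := by gcongr
      _ = α * v / 2 := by ring
  calc _ ≤ (n : ℝ≥0∞) * (ENNReal.ofReal (α / (4 * n)) * ENNReal.ofReal v +
        ENNReal.ofReal (α * g / e / (4 * n)) * ENNReal.ofReal e) := by rw [hv]; gcongr
    _ = ENNReal.ofReal (n * (α / (4 * n) * v + α * g / e / (4 * n) * e)) := by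
        rw [← ENNReal.ofReal_mul (by positivity), ← ENNReal.ofReal_mul (by positivity),
          ← ENNReal.ofReal_add (by positivity) (by positivity), ← ENNReal.ofReal_natCast,
          ← ENNReal.ofReal_mul (by positivity)]
    _ < ENNReal.ofReal (α * v) :=
        (ENNReal.ofReal_lt_ofReal_iff (by positivity)).2
          (hhalf.trans_lt (half_lt_self (by positivity)))
    _ = ∫⁻ _ in G, ENNReal.ofReal α := by rw [setLIntegral_const, hv, ENNReal.ofReal_mul hα.le]
    _ ≤ _ := setLIntegral_mono' hG.measurableSet hGE

theorem IsLineFamily.pow_le_mul_pow (hG : IsLineFamily S A τ G) (hE : MeasurableSet E) (hd : 2 ≤ d)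
    (hα : 0 < α) (he : 0 < e) (hg : 0 < g) (hA : 0 < A) (hτ : 0 < τ)
    (hEe : volume E ≤ ENNReal.ofReal e) (hGg : ENNReal.ofReal g ≤ volume G)
    (hGE : ∀ ℓ ∈ G, ENNReal.ofReal α ≤ lineMeasure (momentCurve d) E ℓ)
    {η : ℝ} (hη0 : 0 < η) (hη1 : η < 1) :
    (α / (4 * (d - 1)) * (α * g / e / (4 * (d - 1)) / 2)) ^ (d - 1) ≤
      A * (((α * g / e / (16 * d * (d - 1))) ^ (d / 2 - 1 + η))⁻¹ *
        ((2 / η + 1) * τ ^ η)) ^ (d - 1) := by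
  have hcast : ((d - 1 : ℕ) : ℝ) = d - 1 := by rw [Nat.cast_sub (by omega), Nat.cast_one]
  have hd1 : (0 : ℝ) < d - 1 := by rw [← hcast]; exact_mod_cast (by omega : 0 < d - 1)
  obtain ⟨ℓ, hℓ⟩ := hG.refinedLines_nonempty hE (n := d - 1) (by omega) hα he hg hEe hGg hGE
  rw [hcast] at hℓ
  have hδ : 4 * (α * g / e / (16 * d * (d - 1))) * (({ℓ.1} : Finset ℝ).card + (d - 1 : ℕ)) ≤
      α * g / e / (4 * (d - 1)) := by
    rw [Finset.card_singleton, hcast]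
    refine le_of_eq ?_
    push_cast
    field_simp
    ring
  have hlower := pow_le_volume_separatedPaths (measurable_momentCurve d)
    hG.measurableSet_directions hE hG.measurableSet hG.fst_mem (by positivity) (d - 1) hℓ hδ
  have hupper := volume_separatedPaths_le hG.measurableSet_directions hG.measurableSet
    hG.volume_fibre_le (δ := α * g / e / (16 * d * (d - 1))) (by positivity) hτ
    hG.volume_directions_le hη0 hη1 ℓ
  have h := hlower.trans hupper
  rwa [← ENNReal.ofReal_mul (by positivity), ← ENNReal.ofReal_pow (by positivity),
    ← ENNReal.ofReal_mul hA.le, ENNReal.ofReal_le_ofReal_iff (by positivity)] at h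

theorem IsLineFamily.exists_mul_rpow_le (hd : 2 ≤ d) {η : ℝ} (hη0 : 0 < η) (hη1 : η < 1) :
    ∃ K : ℝ, 0 < K ∧ ∀ {S : Set ℝ} {E G : Set (Space d)} {A τ α e g : ℝ},
      IsLineFamily S A τ G → MeasurableSet E → 0 < α → 0 < e → 0 < g → 0 < A → 0 < τ →
      volume E ≤ ENNReal.ofReal e → ENNReal.ofReal g ≤ volume G →
      (∀ ℓ ∈ G, ENNReal.ofReal α ≤ lineMeasure (momentCurve d) E ℓ) →
      α * (α * g / e) ^ (d / 2 + η) ≤ K * A ^ (1 / ((d : ℝ) - 1)) * τ ^ η := by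
  have hcast : ((d - 1 : ℕ) : ℝ) = d - 1 := by rw [Nat.cast_sub (by omega), Nat.cast_one]
  have hd1 : (0 : ℝ) < d - 1 := by rw [← hcast]; exact_mod_cast (by omega : 0 < d - 1)
  set κ : ℝ := d / 2 - 1 + η with hκ
  refine ⟨32 * ((d : ℝ) - 1) ^ 2 * (16 * d * (d - 1)) ^ κ * (2 / η + 1), by positivity, ?_⟩
  intro S E G A τ α e g hG hE hα he hg hA hτ hEe hGg hGE
  have hpow := hG.pow_le_mul_pow hE hd hα he hg hA hτ hEe hGg hGE hη0 hη1
  set x := α * g / e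
  have hx : 0 < x := by positivity
  have hroot : A = (A ^ (1 / ((d : ℝ) - 1))) ^ (d - 1) := by
    rw [← hcast, one_div, Real.rpow_inv_natCast_pow hA.le (by omega)]
  rw [hroot, ← mul_pow, pow_le_pow_iff_left₀ (by positivity) (by positivity) (by omega)] at hpow
  have hxκ : x ^ (d / 2 + η) = x * x ^ κ := by
    rw [show (d : ℝ) / 2 + η = 1 + κ by ring, Real.rpow_add hx, Real.rpow_one]
  rw [← hκ, Real.div_rpow hx.le (by positivity), inv_div] at hpow
  calc α * x ^ (d / 2 + η)
      = 32 * ((d : ℝ) - 1) ^ 2 * x ^ κ * (α / (4 * (d - 1)) * (x / (4 * (d - 1)) / 2)) := by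
        rw [hxκ]; field_simp; ring
    _ ≤ 32 * ((d : ℝ) - 1) ^ 2 * x ^ κ * (A ^ (1 / ((d : ℝ) - 1)) *
        ((16 * d * (d - 1)) ^ κ / x ^ κ * ((2 / η + 1) * τ ^ η))) := by gcongr
    _ = _ := by field_simp

end LineFamily

theorem ae_xray_chi_eq_lineMeasure {d : ℕ} {E E' : Set (Space d)} (hE' : MeasurableSet E')
    (h : E =ᵐ[volume] E') : ∀ᵐ ℓ, xray d (chi E) ℓ = lineMeasure (momentCurve d) E' ℓ := by
  have hγ := measurable_momentCurve d
  filter_upwards [ae_ae_linePoint hγ h] with ℓ hℓ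
  have hmeas : MeasurableSet {s | linePoint (momentCurve d) ℓ s ∈ E'} :=
    ((measurable_linePoint hγ).comp measurable_prodMk_left) hE'
  rw [lineMeasure, ← lintegral_indicator_one hmeas]
  exact lintegral_congr_ae (indicator_ae_eq_of_ae_eq_set (f := fun _ => 1) hℓ)

section Exponents

theorem one_div_conjExponent_inv {w : ℝ} (hw : w ≠ 0) : 1 / Real.conjExponent w⁻¹ = 1 - w := by
  rw [Real.conjExponent, one_div_div]
  field_simp

theorem one_div_pExp (d : ℕ) (θ : ℝ) : 1 / pExp d θ = 1 - 2 * θ / (d + 2) := by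
  have : (d : ℝ) + 2 ≠ 0 := by positivity
  rw [pExp, one_div, inv_inv]
  field_simp
  ring

theorem one_div_qDual {d : ℕ} (hd : 0 < d) {θ : ℝ} (hθ : 0 < θ) :
    1 / qDual d θ = 1 - 2 * θ / (d + 2) * (d / 2) := by
  rw [qDual, qExp, one_div_conjExponent_inv (by positivity)]
  field_simp

theorem qDual_pos {d : ℕ} (hd : 0 < d) {θ : ℝ} (hθ0 : 0 < θ) (hθ1 : θ < 1) : 0 < qDual d θ := by
  rw [← one_div_pos, one_div_qDual hd hθ0, sub_pos]
  calc 2 * θ / (d + 2) * (d / 2) = θ * d / (d + 2) := by field_simp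
    _ < 1 := by rw [div_lt_one (by positivity)]; nlinarith

theorem one_div_rDual {d : ℕ} (hd : 2 ≤ d) {θ : ℝ} (hθ0 : 0 ≤ θ) (hθ1 : θ < 1) :
    1 / rDual d θ = 2 * θ / (d + 2) * (d / (d - 1)) := by
  have hd' : (2 : ℝ) ≤ d := by exact_mod_cast hd
  have hd1 : (d : ℝ) - 1 ≠ 0 := by linarith
  have hfactor : (d : ℝ) ^ 2 + d - 2 = (d + 2) * (d - 1) := by ring
  have hnonneg : 0 ≤ θ * ((d : ℝ) ^ 2 - d - 2) / ((d : ℝ) ^ 2 + d - 2) :=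
    div_nonneg (mul_nonneg hθ0 (by nlinarith)) (by nlinarith)
  rw [rDual, rExp, one_div_conjExponent_inv (by linarith), hfactor]
  field_simp
  ring

theorem rDual_pos {d : ℕ} (hd : 2 ≤ d) {θ : ℝ} (hθ0 : 0 < θ) (hθ1 : θ < 1) : 0 < rDual d θ := by
  have hd' : (2 : ℝ) ≤ d := by exact_mod_cast hd
  have hd1 : (0 : ℝ) < d - 1 := by linarith
  rw [← one_div_pos, one_div_rDual hd hθ0.le hθ1]
  positivity

end Exponents

section MixedNorm

variable {d : ℕ} {q r m M A : ℝ} {F F' : Set (Space d)} {T : Set ℝ}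

theorem fibreNorm_congr_ae {f g : Space d → ℝ≥0∞} (h : f =ᵐ[volume] g) (r : ℝ) :
    fibreNorm r f =ᵐ[volume] fibreNorm r g := by
  filter_upwards [Measure.ae_ae_of_ae_prod h] with t ht
  exact eLpNorm_congr_ae ht

theorem mixedNorm_congr_ae {f g : Space d → ℝ≥0∞} (h : f =ᵐ[volume] g) (q r : ℝ) :
    mixedNorm q r f = mixedNorm q r g :=
  eLpNorm_congr_ae (fibreNorm_congr_ae h r)

theorem chi_congr_ae (h : F =ᵐ[volume] F') : chi F =ᵐ[volume] chi F' :=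
  indicator_ae_eq_of_ae_eq_set h

theorem FibreComparable.congr_ae (hF : FibreComparable m M r A T F) (h : F =ᵐ[volume] F') :
    FibreComparable m M r A T F' := by
  filter_upwards [hF, fibreNorm_congr_ae (chi_congr_ae h) r] with t ht hnorm
  rwa [← hnorm]

theorem fibreNorm_chi (hF : MeasurableSet F) (hr : 0 < r) (t : ℝ) :
    fibreNorm r (chi F) t = volume (Prod.mk t ⁻¹' F) ^ (1 / r) := by
  have hchi : (fun y => chi F (t, y)) = (Prod.mk t ⁻¹' F).indicator fun _ => (1 : ℝ≥0∞) := rfl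
  rw [fibreNorm, hchi, eLpNorm_indicator_const (measurable_prodMk_left hF) (by simpa using hr)
    ENNReal.ofReal_ne_top, ENNReal.toReal_ofReal hr.le, enorm_eq_self, one_mul]

/-- The directions `t` in which `|F_t|` is comparable to `A`, with constants `m` and `M`: a
measurable substitute for the set `T` of `FibreComparable`, with which it agrees almost
everywhere. -/
def comparableDirections (m M A : ℝ) (F : Set (Space d)) : Set ℝ :=
  {t | volume (Prod.mk t ⁻¹' F) ∈ Set.Icc (ENNReal.ofReal (m * A)) (ENNReal.ofReal (M * A))}

theorem measurableSet_comparableDirections (m M A : ℝ) (hF : MeasurableSet F) :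
    MeasurableSet (comparableDirections m M A F) :=
  measurable_measure_prodMk_left hF measurableSet_Icc

theorem mul_volume_comparableDirections_le (m M A : ℝ) (hF : MeasurableSet F) :
    ENNReal.ofReal (m * A) * volume (comparableDirections m M A F) ≤ volume F := by
  rw [Measure.volume_eq_prod, Measure.prod_apply hF, ← setLIntegral_const]
  exact (setLIntegral_mono' (measurableSet_comparableDirections m M A hF) fun t ht => ht.1).trans
    (setLIntegral_le_lintegral _ _)

theorem mul_volume_comparableDirections_rpow_le_mixedNorm (hF : MeasurableSet F) (hq : 0 < q)
    (hr : 0 < r) (m M A : ℝ) :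
    ENNReal.ofReal (m * A) ^ (1 / r) * volume (comparableDirections m M A F) ^ (1 / q) ≤
      mixedNorm q r (chi F) := by
  set S := comparableDirections m M A F
  calc _ = eLpNorm (S.indicator fun _ => ENNReal.ofReal (m * A) ^ (1 / r)) (ENNReal.ofReal q)
        volume := by
        rw [eLpNorm_indicator_const (measurableSet_comparableDirections m M A hF)
          (by simpa using hq) ENNReal.ofReal_ne_top, ENNReal.toReal_ofReal hq.le, enorm_eq_self]
    _ ≤ mixedNorm q r (chi F) := by
        refine eLpNorm_mono_enorm fun t => ?_
        rw [fibreNorm_chi hF hr, enorm_eq_self, enorm_eq_self]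
        by_cases ht : t ∈ S
        · rw [Set.indicator_of_mem ht]
          exact ENNReal.rpow_le_rpow ht.1 (by positivity)
        · exact (Set.indicator_of_notMem ht _).trans_le zero_le

theorem FibreComparable.ae_mem_or_volume_eq_zero (h : FibreComparable m M r A T F)
    (hF : MeasurableSet F) (hr : 0 < r) :
    ∀ᵐ t, t ∈ comparableDirections m M A F ∨ volume (Prod.mk t ⁻¹' F) = 0 := by
  filter_upwards [h] with t ht
  rw [fibreNorm_chi hF hr, ← ENNReal.rpow_mul, one_div_mul_cancel hr.ne', ENNReal.rpow_one] at ht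
  by_cases hT : t ∈ T
  · rw [Set.indicator_of_mem hT, Set.indicator_of_mem hT] at ht
    exact Or.inl ht
  · rw [Set.indicator_of_notMem hT, Set.indicator_of_notMem hT] at ht
    exact Or.inr (nonpos_iff_eq_zero.1 ht.2)

theorem FibreComparable.volume_le_mul (h : FibreComparable m M r A T F) (hF : MeasurableSet F)
    (hr : 0 < r) :
    volume F ≤ ENNReal.ofReal (M * A) * volume (comparableDirections m M A F) := by
  have hS := measurableSet_comparableDirections m M A hF
  rw [Measure.volume_eq_prod, Measure.prod_apply hF, ← lintegral_indicator_const hS]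
  refine lintegral_mono_ae ?_
  filter_upwards [h.ae_mem_or_volume_eq_zero hF hr] with t ht
  by_cases htS : t ∈ comparableDirections m M A F
  · simpa only [Set.indicator_of_mem htS] using htS.2
  · simp [ht.resolve_left htS]

theorem FibreComparable.ae_fst_mem (h : FibreComparable m M r A T F) (hF : MeasurableSet F)
    (hr : 0 < r) : ∀ᵐ z : Space d, z ∈ F → z.1 ∈ comparableDirections m M A F := by
  have hS := measurableSet_comparableDirections m M A hF
  have hbad : volume (F \ Prod.fst ⁻¹' comparableDirections m M A F) = 0 := by
    rw [Measure.volume_eq_prod, Measure.measure_prod_null (hF.diff (measurable_fst hS))]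
    filter_upwards [h.ae_mem_or_volume_eq_zero hF hr] with t ht
    refine ht.elim (fun htS => ?_) fun h0 => measure_mono_null (fun y hy => hy.1) h0
    exact measure_mono_null (fun y hy => hy.2 htS) measure_empty
  filter_upwards [measure_eq_zero_iff_ae_notMem.1 hbad] with z hz hzF
  exact by_contra fun hzS => hz ⟨hzF, hzS⟩

theorem FibreComparable.volume_comparableDirections_pos (h : FibreComparable m M r A T F)
    (hF : MeasurableSet F) (hr : 0 < r) (hF0 : 0 < volume F) :
    0 < volume (comparableDirections m M A F) :=
  pos_iff_ne_zero.2 (right_ne_zero_of_mul (hF0.trans_le (h.volume_le_mul hF hr)).ne')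

theorem volume_comparableDirections_lt_top (hF : MeasurableSet F) (hmA : 0 < m * A) (M : ℝ)
    (hFtop : volume F < ∞) : volume (comparableDirections m M A F) < ∞ :=
  ENNReal.lt_top_of_mul_ne_top_right
    ((mul_volume_comparableDirections_le m M A hF).trans_lt hFtop).ne
    (ENNReal.ofReal_pos.2 hmA).ne'

theorem FibreComparable.ofReal_div_le_mixedNorm_mul_inv (h : FibreComparable m M r A T F)
    (hF : MeasurableSet F) (hq : 0 < q) (hr : 0 < r) (hm : 0 < m) (hM : 0 < M) (hA : 0 < A) {τ : ℝ}
    (hτ : 0 < τ) (hS : volume (comparableDirections m M A F) = ENNReal.ofReal τ) :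
    ENNReal.ofReal ((m * A) ^ (1 / r) * τ ^ (1 / q) / (M * A * τ)) ≤
      mixedNorm q r (chi F) * (volume F)⁻¹ := by
  have hnorm := mul_volume_comparableDirections_rpow_le_mixedNorm hF hq hr m M A
  have hvol := h.volume_le_mul hF hr
  rw [hS, ENNReal.ofReal_rpow_of_pos (by positivity), ENNReal.ofReal_rpow_of_pos hτ,
    ← ENNReal.ofReal_mul (by positivity)] at hnorm
  rw [hS, ← ENNReal.ofReal_mul (by positivity)] at hvol
  rw [ENNReal.ofReal_div_of_pos (by positivity), ENNReal.div_eq_inv_mul, mul_comm]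
  gcongr

theorem FibreComparable.exists_isLineFamily_ae_eq (h : FibreComparable m M r A T F)
    (hF : MeasurableSet F) (hF' : NullMeasurableSet F') (hr : 0 < r) (hsub : F' ≤ᵐ[volume] F)
    {τ : ℝ} (hS : volume (comparableDirections m M A F) = ENNReal.ofReal τ) :
    ∃ G, IsLineFamily (comparableDirections m M A F) (M * A) τ G ∧ G =ᵐ[volume] F' := by
  obtain ⟨F'', -, hF'', hF''F'⟩ := hF'.exists_measurable_superset_ae_eq
  have hSm := measurableSet_comparableDirections m M A hF
  refine ⟨F'' ∩ F ∩ Prod.fst ⁻¹' comparableDirections m M A F,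
    ⟨(hF''.inter hF).inter (measurable_fst hSm), hSm, fun ℓ hℓ => hℓ.2, hS.le, fun t => ?_⟩, ?_⟩
  · by_cases ht : t ∈ comparableDirections m M A F
    · exact (measure_mono fun y hy => hy.1.2).trans ht.2
    · exact (measure_mono fun y hy => ht hy.2).trans (measure_empty.trans_le zero_le)
  · filter_upwards [hF''F', hsub, h.ae_fst_mem hF hr] with z hz hzsub hzS
    exact propext ⟨fun hzG => hz.mp hzG.1.1,
      fun hzF' => ⟨⟨hz.mpr hzF', hzsub hzF'⟩, hzS (hzsub hzF')⟩⟩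

theorem FibreComparable.exists_isLineFamily (h : FibreComparable m M r A T F)
    (hF : NullMeasurableSet F) (hF' : NullMeasurableSet F') (hq : 0 < q) (hr : 0 < r) (hm : 0 < m)
    (hM : 0 < M) (hA : 0 < A) (hF0 : 0 < volume F) (hFtop : volume F < ∞) (hsub : F' ⊆ F) {κ : ℝ}
    (hκ : 0 ≤ κ) (hlarge : ENNReal.ofReal κ * volume F ≤ volume F') :
    ∃ (S : Set ℝ) (τ : ℝ) (G : Set (Space d)), 0 < τ ∧ IsLineFamily S (M * A) τ G ∧
      G =ᵐ[volume] F' ∧ ENNReal.ofReal (κ * (m * A * τ)) ≤ volume G ∧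
      ENNReal.ofReal ((m * A) ^ (1 / r) * τ ^ (1 / q) / (M * A * τ)) ≤
        mixedNorm q r (chi F) * (volume F)⁻¹ := by
  obtain ⟨F₀, -, hF₀, hF₀F⟩ := hF.exists_measurable_superset_ae_eq
  have h₀ := h.congr_ae hF₀F.symm
  have hvol : volume F₀ = volume F := measure_congr hF₀F
  rw [← hvol] at hF0 hFtop hlarge
  set S := comparableDirections m M A F₀
  have hS0 : 0 < volume S := h₀.volume_comparableDirections_pos hF₀ hr hF0
  have hStop : volume S < ∞ :=
    volume_comparableDirections_lt_top hF₀ (mul_pos hm hA) M hFtop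
  obtain ⟨τ, hτ, hSτ⟩ : ∃ τ : ℝ, 0 < τ ∧ volume S = ENNReal.ofReal τ :=
    ⟨_, ENNReal.toReal_pos hS0.ne' hStop.ne, (ENNReal.ofReal_toReal hStop.ne).symm⟩
  obtain ⟨G, hG, hGF'⟩ := h₀.exists_isLineFamily_ae_eq hF₀ hF' hr
    (hsub.eventuallyLE.trans hF₀F.symm.le) hSτ
  refine ⟨S, τ, G, hτ, hG, hGF', ?_, ?_⟩
  · calc ENNReal.ofReal (κ * (m * A * τ))
        = ENNReal.ofReal κ * (ENNReal.ofReal (m * A) * volume S) := by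
          rw [hSτ, ← ENNReal.ofReal_mul (by positivity), ← ENNReal.ofReal_mul hκ]
      _ ≤ ENNReal.ofReal κ * volume F₀ := by
          gcongr
          exact mul_volume_comparableDirections_le m M A hF₀
      _ ≤ volume F' := hlarge
      _ = volume G := (measure_congr hGF').symm
  · rw [← hvol, ← mixedNorm_congr_ae (chi_congr_ae hF₀F) q r]
    exact h₀.ofReal_div_le_mixedNorm_mul_inv hF₀ hq hr hm hM hA hτ hSτ

end MixedNorm

section CriticalSize

/-- The logarithm of the ratio of `e` to the critical size `A^{d/(d-1)} τ^{-d/2}`. For `e = |E|` and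
`F` with `|T| = τ`, the proof shows that it is `O(1 + |log ε|)`, so that `|E|` is determined by `F`
up to a power of `ε`. -/
def logRatio (d : ℕ) (A τ e : ℝ) : ℝ :=
  Real.log e - d / (d - 1) * Real.log A + d / 2 * Real.log τ

/-- The size of `threshold d θ ε E F` in terms of `e = |E|`, the fibre size `A` of `F` and the
measure `τ` of its set of directions, up to the choice of the constants `m` and `M`. -/
def modelThreshold (d : ℕ) (θ ε m M A τ e : ℝ) : ℝ :=
  ε * e ^ (1 / pExp d θ) *
    ((m * A) ^ (1 / rDual d θ) * τ ^ (1 / qDual d θ) / (M * A * τ))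

variable {d : ℕ} {θ ε m M A τ e : ℝ}

theorem modelThreshold_pos (hε : 0 < ε) (hm : 0 < m) (hM : 0 < M) (hA : 0 < A) (hτ : 0 < τ)
    (he : 0 < e) : 0 < modelThreshold d θ ε m M A τ e := by
  unfold modelThreshold
  positivity

theorem ofReal_modelThreshold_le_threshold {E F : Set (Space d)} (hε : 0 ≤ ε) (he : 0 < e)
    (hEe : volume E = ENNReal.ofReal e)
    (hF : ENNReal.ofReal
        ((m * A) ^ (1 / rDual d θ) * τ ^ (1 / qDual d θ) / (M * A * τ)) ≤
      mixedNorm (qDual d θ) (rDual d θ) (chi F) * (volume F)⁻¹) :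
    ENNReal.ofReal (modelThreshold d θ ε m M A τ e) ≤ threshold d θ ε E F := by
  rw [modelThreshold, threshold, hEe, ENNReal.ofReal_rpow_of_pos he,
    ENNReal.ofReal_mul (by positivity), ENNReal.ofReal_mul hε, mul_assoc _ (mixedNorm _ _ _)]
  gcongr

theorem log_modelThreshold (hd : 2 ≤ d) (hθ0 : 0 < θ) (hθ1 : θ < 1) (hε : 0 < ε) (hm : 0 < m)
    (hM : 0 < M) (hA : 0 < A) (hτ : 0 < τ) (he : 0 < e) :
    Real.log (modelThreshold d θ ε m M A τ e) =
      Real.log ε + Real.log e - Real.log A - 2 * θ / (d + 2) * logRatio d A τ e +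
        (2 * θ / (d + 2) * (d / (d - 1)) * Real.log m - Real.log M) := by
  have he' := Real.rpow_pos_of_pos he (1 / pExp d θ)
  have hmA' := Real.rpow_pos_of_pos (mul_pos hm hA) (1 / rDual d θ)
  have hτ' := Real.rpow_pos_of_pos hτ (1 / qDual d θ)
  rw [modelThreshold, Real.log_mul (by positivity) (by positivity), Real.log_mul hε.ne' he'.ne',
    Real.log_div (by positivity) (by positivity), Real.log_mul hmA'.ne' hτ'.ne',
    Real.log_mul (by positivity) hτ.ne', Real.log_mul hM.ne' hA.ne', Real.log_rpow he,
    Real.log_rpow (mul_pos hm hA), Real.log_rpow hτ, Real.log_mul hm.ne' hA.ne', one_div_pExp,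
    one_div_qDual (by omega) hθ0, one_div_rDual hd hθ0.le hθ1, logRatio]
  ring

theorem le_mul_logRatio (hd : 2 ≤ d) (hθ0 : 0 < θ) (hθ1 : θ < 1) (hε : 0 < ε) (hm : 0 < m)
    (hM : 0 < M) (hA : 0 < A) (hτ : 0 < τ) (he : 0 < e) {a b : ℝ} (ha : 0 < a)
    (h : modelThreshold d θ ε m M A τ e * (a * ε ^ b * (m * A * τ)) ≤ τ * e) :
    Real.log a + Real.log m + (2 * θ / (d + 2) * (d / (d - 1)) * Real.log m - Real.log M) +
        (1 + b) * Real.log ε ≤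
      2 * θ / (d + 2) * logRatio d A τ e := by
  have hα := modelThreshold_pos (d := d) (θ := θ) hε hm hM hA hτ he
  have hlog := Real.log_le_log (by positivity) h
  rw [Real.log_mul hα.ne' (by positivity), Real.log_mul (by positivity) (by positivity),
    Real.log_mul ha.ne' (by positivity), Real.log_rpow hε, Real.log_mul (by positivity) hτ.ne',
    Real.log_mul hm.ne' hA.ne', Real.log_mul hτ.ne' he.ne',
    log_modelThreshold hd hθ0 hθ1 hε hm hM hA hτ he] at hlog
  linarith

theorem mul_logRatio_le (hd : 2 ≤ d) (hθ0 : 0 < θ) (hθ1 : θ < 1) (hε : 0 < ε) (hm : 0 < m)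
    (hM : 0 < M) (hA : 0 < A) (hτ : 0 < τ) (he : 0 < e) {a b K η P : ℝ} (ha : 0 < a) (hK : 0 < K)
    (hP : P = d / 2 + 1 + η)
    (h : modelThreshold d θ ε m M A τ e *
        (modelThreshold d θ ε m M A τ e * (a * ε ^ b * (m * A * τ)) / e) ^ (d / 2 + η) ≤
      K * (M * A) ^ (1 / ((d : ℝ) - 1)) * τ ^ η) :
    (1 - P * (2 * θ / (d + 2))) * logRatio d A τ e ≤
      Real.log K + 1 / ((d : ℝ) - 1) * Real.log M -
        P * (2 * θ / (d + 2) * (d / (d - 1)) * Real.log m - Real.log M) -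
        (P - 1) * (Real.log a + Real.log m) - (P + (P - 1) * b) * Real.log ε := by
  have hd1 : (d : ℝ) - 1 ≠ 0 := by
    have : (2 : ℝ) ≤ d := by exact_mod_cast hd
    linarith
  have hα := modelThreshold_pos (d := d) (θ := θ) hε hm hM hA hτ he
  have hMA' := Real.rpow_pos_of_pos (mul_pos hM hA) (1 / ((d : ℝ) - 1))
  have hτ' := Real.rpow_pos_of_pos hτ η
  have hlog := Real.log_le_log (by positivity) h
  rw [Real.log_mul hα.ne' (by positivity), Real.log_rpow (by positivity),
    Real.log_div (by positivity) he.ne', Real.log_mul hα.ne' (by positivity),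
    Real.log_mul (by positivity) (by positivity), Real.log_mul ha.ne' (by positivity),
    Real.log_rpow hε, Real.log_mul (by positivity) hτ.ne', Real.log_mul hm.ne' hA.ne',
    Real.log_mul (by positivity) hτ'.ne',
    Real.log_mul hK.ne' hMA'.ne', Real.log_rpow (by positivity), Real.log_mul hM.ne' hA.ne',
    Real.log_rpow hτ, log_modelThreshold hd hθ0 hθ1 hε hm hM hA hτ he,
    show (d : ℝ) / 2 + η = P - 1 by rw [hP]; ring] at hlog
  have hratio : logRatio d A τ e = Real.log e - Real.log A - 1 / ((d : ℝ) - 1) * Real.log A +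
      (P - 1 - η) * Real.log τ := by
    rw [logRatio, hP]
    field_simp
    ring
  linarith

theorem one_sub_mul_pos {P : ℝ} (hθ1 : θ < 1) (hP : P = d / 2 + 1 + (1 - θ) / 2) :
    0 < 1 - P * (2 * θ / (d + 2)) := by
  have hθd : 2 * θ / (d + 2) ≤ 1 := by
    rw [div_le_one (by positivity)]
    linarith [(Nat.cast_nonneg d : (0 : ℝ) ≤ d)]
  calc 0 < 1 - (θ + (1 - θ) / 2 * 1) := by linarith
    _ ≤ 1 - (θ + (1 - θ) / 2 * (2 * θ / (d + 2))) := by gcongr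
    _ = 1 - P * (2 * θ / (d + 2)) := by rw [hP]; field_simp

theorem volume_le_exp_mul_rpow_mul_volume {E₁ E₂ : Set (Space d)} {c k c' k' : ℝ} (hε : 0 < ε)
    (hE₁0 : 0 < volume E₁) (hE₁ : volume E₁ < ∞) (hE₂0 : 0 < volume E₂) (hE₂ : volume E₂ < ∞)
    (hle : logRatio d A τ (volume.real E₁) ≤ c' - k' * Real.log ε)
    (hge : c + k * Real.log ε ≤ logRatio d A τ (volume.real E₂)) :
    volume E₁ ≤ ENNReal.ofReal (Real.exp (c' - c) * ε ^ (-(k + k'))) * volume E₂ := by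
  have he₁ : 0 < volume.real E₁ := ENNReal.toReal_pos hE₁0.ne' hE₁.ne
  have he₂ : 0 < volume.real E₂ := ENNReal.toReal_pos hE₂0.ne' hE₂.ne
  have hpow := Real.rpow_pos_of_pos hε (-(k + k'))
  have h : volume.real E₁ ≤ Real.exp (c' - c) * ε ^ (-(k + k')) * volume.real E₂ := by
    rw [← Real.log_le_log_iff he₁ (by positivity), Real.log_mul (by positivity) he₂.ne',
      Real.log_mul (Real.exp_ne_zero _) hpow.ne', Real.log_exp, Real.log_rpow hε]
    unfold logRatio at hle hge
    linarith
  rw [← ENNReal.ofReal_toReal hE₁.ne, ← ENNReal.ofReal_toReal hE₂.ne,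
    ← ENNReal.ofReal_mul (by positivity)]
  exact ENNReal.ofReal_le_ofReal h

theorem ofReal_inv_mul_rpow_mul_le {C k : ℝ} (hC : 0 < C) (hε : 0 < ε) {x y : ℝ≥0∞}
    (h : x ≤ ENNReal.ofReal (C * ε ^ (-k)) * y) : ENNReal.ofReal (C⁻¹ * ε ^ k) * x ≤ y := by
  have hinv : C⁻¹ * ε ^ k = (C * ε ^ (-k))⁻¹ := by rw [Real.rpow_neg hε.le, mul_inv, inv_inv]
  rw [hinv, ENNReal.ofReal_inv_of_pos (by positivity), ← ENNReal.div_eq_inv_mul]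
  exact ENNReal.div_le_of_le_mul' h

theorem IsLineFamily.exists_le_lineMeasure {S : Set ℝ} {E G : Set (Space d)} {α : ℝ≥0∞}
    (hG : IsLineFamily S A τ G) (hE : NullMeasurableSet E)
    (hα : ∀ᵐ ℓ, ℓ ∈ G → α ≤ xray d (chi E) ℓ) :
    ∃ E' G' : Set (Space d), MeasurableSet E' ∧ volume E' = volume E ∧ IsLineFamily S A τ G' ∧
      volume G ≤ volume G' ∧ ∀ ℓ ∈ G', α ≤ lineMeasure (momentCurve d) E' ℓ := by
  obtain ⟨E', -, hE', hE'E⟩ := hE.exists_measurable_superset_ae_eq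
  refine ⟨E', G ∩ {ℓ | α ≤ lineMeasure (momentCurve d) E' ℓ}, hE', measure_congr hE'E,
    hG.mono (hG.measurableSet.inter (measurableSet_le measurable_const
      (measurable_lineMeasure (measurable_momentCurve d) hE'))) Set.inter_subset_left,
    measure_mono_ae ?_, fun ℓ hℓ => hℓ.2⟩
  filter_upwards [hα, ae_xray_chi_eq_lineMeasure hE' hE'E.symm] with ℓ hℓ hxray hℓG
  exact ⟨hℓG, (hℓ hℓG).trans_eq hxray⟩

theorem exists_logRatio_bounds (hd : 2 ≤ d) (hθ0 : 0 < θ) (hθ1 : θ < 1) {a b : ℝ} (ha : 0 < a)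
    (hb : -1 < b) (hm : 0 < m) (hM : 0 < M) :
    ∃ c k c' k' : ℝ, 0 < k ∧ 0 < k' ∧ ∀ {ε A τ : ℝ} {S : Set ℝ} {G E : Set (Space d)},
      0 < ε → 0 < A → 0 < τ → IsLineFamily S (M * A) τ G →
      ENNReal.ofReal (a * ε ^ b * (m * A * τ)) ≤ volume G →
      NullMeasurableSet E → 0 < volume E → volume E < ∞ →
      (∀ᵐ ℓ, ℓ ∈ G → ENNReal.ofReal (modelThreshold d θ ε m M A τ (volume.real E)) ≤
        xray d (chi E) ℓ) →
      c + k * Real.log ε ≤ logRatio d A τ (volume.real E) ∧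
        logRatio d A τ (volume.real E) ≤ c' - k' * Real.log ε := by
  obtain ⟨K, hK, hpath⟩ := IsLineFamily.exists_mul_rpow_le (d := d) (η := (1 - θ) / 2) hd
    (by linarith) (by linarith)
  have hu : 0 < 2 * θ / ((d : ℝ) + 2) := by positivity
  obtain ⟨P, hP⟩ : ∃ P : ℝ, P = d / 2 + 1 + (1 - θ) / 2 := ⟨_, rfl⟩
  have hPu := one_sub_mul_pos hθ1 hP
  have hP1 : 1 < P := by linarith [(Nat.cast_nonneg d : (0 : ℝ) ≤ d)]
  set C₀ : ℝ := 2 * θ / (d + 2) * (d / (d - 1)) * Real.log m - Real.log M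
  refine ⟨(Real.log a + Real.log m + C₀) / (2 * θ / (d + 2)), (1 + b) / (2 * θ / (d + 2)),
    (Real.log K + 1 / ((d : ℝ) - 1) * Real.log M - P * C₀ -
      (P - 1) * (Real.log a + Real.log m)) / (1 - P * (2 * θ / (d + 2))),
    (P + (P - 1) * b) / (1 - P * (2 * θ / (d + 2))),
    div_pos (by linarith) hu, div_pos (by nlinarith) hPu, ?_⟩
  intro ε A τ S G E hε hA hτ hG hGvol hE hE0 hEtop hlevel
  have he : 0 < volume.real E := ENNReal.toReal_pos hE0.ne' hEtop.ne
  have hα := modelThreshold_pos (d := d) (θ := θ) hε hm hM hA hτ he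
  obtain ⟨E', G', hE', hE'E, hG', hGG', hG'E'⟩ := hG.exists_le_lineMeasure hE hlevel
  have hE'vol : volume E' ≤ ENNReal.ofReal (volume.real E) :=
    hE'E.trans_le (ENNReal.ofReal_toReal hEtop.ne).ge
  constructor
  · rw [div_mul_eq_mul_div _ _ (Real.log ε), ← add_div, div_le_iff₀' hu]
    exact le_mul_logRatio hd hθ0 hθ1 hε hm hM hA hτ he ha
      (hG'.mul_le_mul hE' hα he hτ hE'vol (hGvol.trans hGG') hG'E')
  · rw [div_mul_eq_mul_div _ _ (Real.log ε), ← sub_div, le_div_iff₀' hPu]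
    exact mul_logRatio_le hd hθ0 hθ1 hε hm hM hA hτ he ha hK hP
      (hpath hG' hE' hα he (by positivity) (mul_pos hM hA) hτ hE'vol (hGvol.trans hGG') hG'E')

end CriticalSize

end RestrictedXray
end

theorem mainTheorem6_general (d : ℕ) (hd : 2 ≤ d) (θ : ℝ) (hθ0 : 0 < θ) (hθ1 : θ < 1)
    (a b m M : ℝ) (ha : 0 < a) (hb : -1 < b) (hm : 0 < m) (hM : 0 < M) :
    ∃ c C k : ℝ, 0 < c ∧ 0 < C ∧ 0 < k ∧
      ∀ (ε : ℝ), 0 < ε →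
      ∀ (E₁ E₂ F F' : Set (RestrictedXray.Space d)) (A : ℝ) (T : Set ℝ),
        NullMeasurableSet E₁ volume → NullMeasurableSet E₂ volume →
        NullMeasurableSet F volume → NullMeasurableSet F' volume →
        0 < volume E₁ → volume E₁ < ∞ →
        0 < volume E₂ → volume E₂ < ∞ →
        0 < volume F → volume F < ∞ →
        0 < A →
        RestrictedXray.FibreComparable m M (RestrictedXray.rDual d θ) A T F →
        F' ⊆ F →
        ENNReal.ofReal (a * ε ^ b) * volume F ≤ volume F' →
        (∀ᵐ z : RestrictedXray.Space d, z ∈ F' →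
          RestrictedXray.threshold d θ ε E₁ F ≤ RestrictedXray.xray d (RestrictedXray.chi E₁) z) →
        (∀ᵐ z : RestrictedXray.Space d, z ∈ F' →
          RestrictedXray.threshold d θ ε E₂ F ≤ RestrictedXray.xray d (RestrictedXray.chi E₂) z) →
        ENNReal.ofReal (c * ε ^ k) * volume E₁ ≤ volume E₂ ∧
          volume E₂ ≤ ENNReal.ofReal (C * ε ^ (-k)) * volume E₁ := by
  open RestrictedXray in
  obtain ⟨c, k, c', k', hk, hk', hbounds⟩ := exists_logRatio_bounds hd hθ0 hθ1 ha hb hm hM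
  refine ⟨(Real.exp (c' - c))⁻¹, Real.exp (c' - c), k + k', by positivity, by positivity,
    by positivity, ?_⟩
  intro ε hε E₁ E₂ F F' A T hE₁ hE₂ hF hF' hE₁0 hE₁top hE₂0 hE₂top hF0 hFtop hA hcomp hsub hlarge
    hX₁ hX₂
  obtain ⟨S, τ, G, hτ, hG, hGF', hGvol, hnorm⟩ := hcomp.exists_isLineFamily hF hF'
    (qDual_pos (two_pos.trans_le hd) hθ0 hθ1) (rDual_pos hd hθ0 hθ1) hm hM hA hF0 hFtop hsub
    (by positivity) hlarge
  have hratio {E : Set (Space d)} (hE : NullMeasurableSet E) (hE0 : 0 < volume E)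
      (hEtop : volume E < ∞) (hX : ∀ᵐ z, z ∈ F' → threshold d θ ε E F ≤ xray d (chi E) z) :
      c + k * Real.log ε ≤ logRatio d A τ (volume.real E) ∧
        logRatio d A τ (volume.real E) ≤ c' - k' * Real.log ε := by
    refine hbounds hε hA hτ hG hGvol hE hE0 hEtop ?_
    filter_upwards [hX, hGF'.le] with z hz hzF' hzG
    exact (ofReal_modelThreshold_le_threshold hε.le (ENNReal.toReal_pos hE0.ne' hEtop.ne)
      (ENNReal.ofReal_toReal hEtop.ne).symm hnorm).trans (hz (hzF' hzG))
  obtain ⟨hge₁, hle₁⟩ := hratio hE₁ hE₁0 hE₁top hX₁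
  obtain ⟨hge₂, hle₂⟩ := hratio hE₂ hE₂0 hE₂top hX₂
  exact ⟨ofReal_inv_mul_rpow_mul_le (Real.exp_pos _) hε
      (volume_le_exp_mul_rpow_mul_volume hε hE₁0 hE₁top hE₂0 hE₂top hle₁ hge₂),
    volume_le_exp_mul_rpow_mul_volume hε hE₂0 hE₂top hE₁0 hE₁top hle₂ hge₁⟩

theorem mainTheorem6 (d : ℕ) (hd : 3 ≤ d) (θ : ℝ) (hθ0 : 0 < θ) (hθ1 : θ < 1)
    (a b m M : ℝ) (ha : 0 < a) (hb : 0 < b) (hm : 0 < m) (hM : 0 < M) :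
    ∃ c C k : ℝ, 0 < c ∧ 0 < C ∧ 0 < k ∧
      ∀ (ε : ℝ), 0 < ε →
      ∀ (E₁ E₂ F F' : Set (RestrictedXray.Space d)) (A : ℝ) (T : Set ℝ),
        NullMeasurableSet E₁ volume → NullMeasurableSet E₂ volume →
        NullMeasurableSet F volume → NullMeasurableSet F' volume →
        0 < volume E₁ → volume E₁ < ∞ →
        0 < volume E₂ → volume E₂ < ∞ →
        0 < volume F → volume F < ∞ →
        0 < A →
        RestrictedXray.FibreComparable m M (RestrictedXray.rDual d θ) A T F →
        F' ⊆ F →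
        ENNReal.ofReal (a * ε ^ b) * volume F ≤ volume F' →
        (∀ᵐ z : RestrictedXray.Space d, z ∈ F' →
          RestrictedXray.threshold d θ ε E₁ F ≤ RestrictedXray.xray d (RestrictedXray.chi E₁) z) →
        (∀ᵐ z : RestrictedXray.Space d, z ∈ F' →
          RestrictedXray.threshold d θ ε E₂ F ≤ RestrictedXray.xray d (RestrictedXray.chi E₂) z) →
        ENNReal.ofReal (c * ε ^ k) * volume E₁ ≤ volume E₂ ∧
          volume E₂ ≤ ENNReal.ofReal (C * ε ^ (-k)) * volume E₁ :=
  mainTheorem6_general d (by omega) θ hθ0 hθ1 a b m M ha (by linarith) hm hM
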